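/- A *tensor network embedding* consists of a finite simple graph on a vertex set $V_E$, $|V_E|=N_E$, with an array (tensor) $\mathcal A_v$ at each vertex $v$; the edges of the graph are dimensions contracted between the two adjacent tensors, and in addition finitely many uncontracted dimensions are each attached to one vertex, some as input dimensions (set $\bar E$, $N=|\bar E|$) and some as output dimensions. Summing the product of all tensors over all contracted indices and grouping the output dimensions into the row and the input dimensions into the column gives a matrix $S$. The embedding is *Gaussian* if, for some ordering (linearization) of the vertices, the entries of all tensors are independent and those of $\mathcal A_v$ are $N(0,1/r_v)$-distributed, where $r_v$ is the product of the sizes of the output dimensions at $v$ and of the contracted dimensions that $v$ shares with later vertices (so every $\mathcal A_v$, unfolded with these dimensions as rows, is a normalized Gaussian matrix). A random matrix $S$ is *$(\epsilon,\delta)$-accurate* if $\Pr\big(\big|\|Sx\|_2^2-1\big|>\epsilon\big)<\delta$ for every fixed vector $x$ with $\|x\|_2=1$. **Corollary.** For every $\delta_0<1$ there is a constant $C>0$, depending only on $\delta_0$, such that the following holds for all $0<\epsilon\le 1$ and $0<\delta\le\delta_0$. Consider a Gaussian tensor network embedding that has exactly one output dimension, of size $m$, all of whose contracted dimensions have size $m$,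 and whose input dimensions have arbitrary sizes. 1. If the graph of the embedding is a tree and $m\ge C\,N_E\log(1/\delta)/\epsilon^2$, then the embedding is $(\epsilon,\delta)$-accurate. 2. If the embedding is a tensor train (MPS), that is, its graph is a path, each vertex carries exactly one input dimension, and the output dimension is attached to an endpoint of the path, and if $m\ge C\,N\log(1/\delta)/\epsilon^2$, where $N$ is the number of input dimensions, then the embedding is $(\epsilon,\delta)$-accurate. In particular, a sketch size $m=\Theta(N_E\log(1/\delta)/\epsilon^2)$, respectively $m=\Theta(N\log(1/\delta)/\epsilon^2)$, with a sufficiently large constant suffices. -/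

import Mathlib

open MeasureTheory ProbabilityTheory

/-- The structure of a tensor network embedding: a graph whose vertices `V` carry the tensors and
whose edges are the contracted dimensions, together with uncontracted edges, each attached to one
vertex: those indexed by `I` are the input dimensions (the ones that connect the embedding to the
data) and those indexed by `O` are the output (sketch) dimensions. Every edge carries the size of
the dimension which it stands for. -/
structure TensorNetworkEmbedding (V I O : Type*) where
  graph : SimpleGraph V
  bondDim : graph.edgeSet → ℕ
  inVertex : I → V
  inDim : I → ℕ
  outVertex : O → V
  outDim : O → ℕ

namespace TensorNetworkEmbedding

variable {V I O : Type*} (T : TensorNetworkEmbedding V I O)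

/-- All edges: contracted, input, and output ones. -/
abbrev Edge : Type _ := T.graph.edgeSet ⊕ (I ⊕ O)

/-- The dimension size represented by an edge. -/
def size : T.Edge → ℕ
  | Sum.inl e => T.bondDim e
  | Sum.inr (Sum.inl i) => T.inDim i
  | Sum.inr (Sum.inr o) => T.outDim o

/-- The edge `e` is adjacent to the vertex `v`. -/
def Incident : T.Edge → V → Prop
  | Sum.inl e, v => v ∈ (e : Sym2 V)
  | Sum.inr (Sum.inl i), v => T.inVertex i = v
  | Sum.inr (Sum.inr o), v => T.outVertex o = v

/-- Multi-indices of the tensor at `v`: one coordinate for each edge adjacent to `v`. -/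
abbrev TensorIndex (v : V) : Type _ := (e : {e : T.Edge // T.Incident e v}) → Fin (T.size e.1)

/-- Multi-indices of the contracted dimensions. -/
abbrev BondIndex : Type _ := (e : T.graph.edgeSet) → Fin (T.bondDim e)

/-- Multi-indices of the input dimensions: the columns of the embedding matrix. -/
abbrev InIndex : Type _ := (i : I) → Fin (T.inDim i)

/-- Multi-indices of the output dimensions: the rows of the embedding matrix. -/
abbrev OutIndex : Type _ := (o : O) → Fin (T.outDim o)

/-- The index on every edge, put together from output, input and contracted multi-indices. -/
def label (o : T.OutIndex) (i : T.InIndex) (b : T.BondIndex) : (e : T.Edge) → Fin (T.size e)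
  | Sum.inl e => b e
  | Sum.inr (Sum.inl k) => i k
  | Sum.inr (Sum.inr k) => o k

open Classical in
/-- The matrix represented by the network with tensor `A v` at each vertex `v`: the contraction of
all tensors along the contracted edges, with output dimensions grouped into the row and
input dimensions grouped into the column. -/
noncomputable def contract [Fintype V] (A : (v : V) → T.TensorIndex v → ℝ) :
    Matrix T.OutIndex T.InIndex ℝ :=
  Matrix.of fun o i => ∑ b : T.BondIndex, ∏ v : V, A v (fun e => T.label o i b e.1)

open Classical in
/-- For a linearization, i.e. an ordering `σ` of the vertices: the row size of the matricization of
the tensor at `v` in which the output dimensions at `v` and the contracted dimensions shared with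
later vertices are combined into the row, and all other dimensions into the column. -/
noncomputable def rowSize [Fintype V] [Fintype O] (σ : V ≃ Fin (Fintype.card V)) (v : V) : ℕ :=
  (∏ o : O with T.outVertex o = v, T.outDim o) *
    ∏ e ∈ Finset.univ.filter
      (fun e : T.graph.edgeSet => ∃ u, (e : Sym2 V) = s(v, u) ∧ σ v < σ u), T.bondDim e

/-- The random matrix `S` of the embedding whose tensor at `v` is `Z v / √(row size of v)`. When
the `Z v` are filled with independent standard normal variables, the matricization of every
tensor with respect to the linearization `σ` is thus a (normalized) Gaussian embedding. -/
noncomputable def embeddingMatrix [Fintype V] [Fintype O] (σ : V ≃ Fin (Fintype.card V))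
    {Ω : Type*} (Z : (v : V) → T.TensorIndex v → Ω → ℝ) (ω : Ω) :
    Matrix T.OutIndex T.InIndex ℝ :=
  T.contract fun v k => (1 / √(T.rowSize σ v : ℝ)) * Z v k ω

/-- The tensor train (MPS) structure: the tensors form a path, each tensor carries exactly one
input dimension, and output dimensions occur only at an endpoint of the path. -/
def IsTensorTrain [Fintype V] : Prop :=
  Function.Bijective T.inVertex ∧
    ∃ f : T.graph ≃g SimpleGraph.pathGraph (Fintype.card V),
      ∀ o, (f (T.outVertex o)).val = 0 ∨ (f (T.outVertex o)).val + 1 = Fintype.card V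

end TensorNetworkEmbedding

/-- All entries of all the arrays `Z v` are independent standard normal random variables. -/
def IsIIDStandardNormal {V : Type*} {K : V → Type*} {Ω : Type*} [MeasurableSpace Ω]
    (P : Measure Ω) (Z : (v : V) → K v → Ω → ℝ) : Prop :=
  (∀ v k, HasLaw (Z v k) (gaussianReal 0 1) P) ∧
    iIndepFun (fun p : (v : V) × K v => Z p.1 p.2) P

/-- A random matrix is an `(ε, δ)`-accurate embedding if for every fixed unit vector `x` the
probability of `|‖S x‖₂² - 1| > ε` is less than `δ`. -/
def IsAccurateEmbedding {J K Ω : Type*} [Fintype J] [Fintype K] [MeasurableSpace Ω]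
    (P : Measure Ω) (S : Ω → Matrix J K ℝ) (ε δ : ℝ) : Prop :=
  ∀ x : EuclideanSpace ℝ K, ‖x‖ = 1 →
    P.real {ω | ε < |‖WithLp.toLp 2 ((S ω).mulVec x)‖ ^ 2 - 1|} < δ

/-! Root the tree at the vertex carrying the output dimension. Every tensor then has exactly one
edge towards the root, of size `m`, and acts as an `m`-row Gaussian matrix on its other edges. A
contraction is multilinear, so the normalizations enter only through the product of all row sizes.
By `prod_rowSize_eq_pow` this product is `m ^ |V|` for every linearization, so each tensor may be
scaled by `1 / √m`.

Apply the tensors from the leaves to the root, and condition on all but the last one. The new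
squared norm, divided by the old one, is a convex combination of normalized chi-square variables
with `m` degrees of freedom. These may be dependent, but `x ^ s` is convex for `s ≥ 1` and for `s <
0`, so by Jensen one tensor multiplies the moment of order `s` by at most the chi-square moment
(`lintegral_contract_rpow_le`). Induction (`lmarginal_energy_le`) bounds the moment of order `s` of
`‖S x‖²` by the `|V|`-th power of a bound on the chi-square moment.

The chi-square moments of order `p` and `-p` are at most `exp (p² / m)` and `exp (4 p² / m)`, the
latter for `4 p ≤ m`. With `n = |V|`, Markov's inequality for both signs gives the failure
probability `2 exp (4 n p² / m - p ε / 2)`. The choice `p ≈ m ε / (16 n)` makes it smaller than `δ`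
once `m` is of order `n log (1/δ) / ε²` (`measureReal_abs_sub_one_lt`). For a tensor train the
numbers of vertices and inputs agree. -/

/-! ### Contractions of Gaussian arrays against unit vectors -/

open scoped RealInnerProductSpace in
/-- The coordinates of a standard Gaussian vector along an orthonormal family are independent
standard Gaussians. -/
lemma map_inner_stdGaussian {E O : Type*} [NormedAddCommGroup E] [InnerProductSpace ℝ E]
    [FiniteDimensional ℝ E] [MeasurableSpace E] [BorelSpace E] [Fintype O] {w : O → E}
    (hw : Orthonormal ℝ w) :
    (stdGaussian E).map (fun g => WithLp.toLp 2 fun o => ⟪w o, g⟫) =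
      stdGaussian (EuclideanSpace ℝ O) := by
  have hm : Measurable fun g : E => (WithLp.toLp 2 fun o => ⟪w o, g⟫ : EuclideanSpace ℝ O) := by
    fun_prop
  have := Measure.isProbabilityMeasure_map (μ := stdGaussian E) hm.aemeasurable
  apply Measure.ext_of_charFun (E := EuclideanSpace ℝ O)
  ext t
  have h1 : charFun ((stdGaussian E).map (fun g => (WithLp.toLp 2 fun o => ⟪w o, g⟫ :
      EuclideanSpace ℝ O))) t = charFun (stdGaussian E) (∑ o, t o • w o) := by
    rw [charFun_apply, charFun_apply, integral_map hm.aemeasurable (by fun_prop)]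
    congr 1 with g
    rw [inner_sum, PiLp.inner_apply]
    have h : ∀ o, ⟪⟪w o, g⟫, t o⟫ = ⟪g, t o • w o⟫ := fun o => by
      rw [inner_smul_right, ← real_inner_comm g]
      simp [mul_comm]
    simp only [h]
  rw [h1, charFun_stdGaussian, charFun_stdGaussian]
  have h2 : ‖∑ o, t o • w o‖ ^ 2 = ‖t‖ ^ 2 := by
    rw [← real_inner_self_eq_norm_sq, hw.inner_sum, EuclideanSpace.real_norm_sq_eq]
    exact Finset.sum_congr rfl fun o _ => by simp [sq]
  norm_cast
  rw [h2]

/-- A contraction of a standard Gaussian array against a unit vector is a standard Gaussian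
vector. -/
lemma map_sum_mul_pi_gaussianReal {O C K : Type*} [Fintype O] [Fintype C] [Fintype K]
    (ι : O → C → K) (hι : Function.Injective (Function.uncurry ι)) (u : C → ℝ)
    (hu : ∑ c, u c ^ 2 = 1) :
    (Measure.pi fun _ : K => gaussianReal 0 1).map (fun g o => ∑ c, g (ι o c) * u c) =
      Measure.pi fun _ : O => gaussianReal 0 1 := by
  classical
  let w : O → EuclideanSpace ℝ K := fun o => ∑ c, u c • EuclideanSpace.single (ι o c) (1 : ℝ)
  have hw : Orthonormal ℝ w := by
    rw [orthonormal_iff_ite]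
    intro o o'
    have hinj : ∀ o c o' c', ι o c = ι o' c' ↔ o = o' ∧ c = c' := by
      intro o c o' c'
      have := hι.eq_iff (a := (o, c)) (b := (o', c'))
      simpa using this
    simp only [w, sum_inner, inner_sum, inner_smul_left, inner_smul_right,
      EuclideanSpace.inner_single_left]
    simp only [PiLp.single_apply, hinj]
    by_cases h : o = o'
    · simpa [h, sq] using hu
    · simp [h]
  have h := map_inner_stdGaussian hw
  rw [← map_pi_eq_stdGaussian, ← map_pi_eq_stdGaussian,
    Measure.map_map (by fun_prop) (by fun_prop)] at h
  have h2 := congrArg (Measure.map (MeasurableEquiv.toLp 2 (O → ℝ)).symm) h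
  rw [Measure.map_map (by fun_prop) (by fun_prop), Measure.map_map (by fun_prop) (by fun_prop)]
    at h2
  convert h2 using 2
  · ext g o
    simp [w, sum_inner, inner_smul_left, EuclideanSpace.inner_single_left, mul_comm]
  · symm
    convert Measure.map_id
    rfl

/-! ### Jensen's inequality for positive and negative powers -/

/-- For negative `s` the function `s * log x` is convex, and composing with the increasing convex
exponential preserves this. -/
lemma convexOn_rpow_of_neg {s : ℝ} (hs : s < 0) :
    ConvexOn ℝ (Set.Ioi 0) fun x : ℝ => x ^ s := by
  have h : ConvexOn ℝ (Set.Ioi 0) fun x : ℝ => s * Real.log x := by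
    have := (strictConcaveOn_log_Ioi.concaveOn.neg).smul (neg_nonneg.2 hs.le)
    refine this.congr fun x _ => ?_
    simp
  have h2 : ConvexOn ℝ (Set.Ioi 0) (Real.exp ∘ fun x : ℝ => s * Real.log x) :=
    (convexOn_exp.subset (Set.subset_univ _) (by
      exact (h.1.isPreconnected.image _ (by
        refine ContinuousOn.const_mul ?_ _
        exact Real.continuousOn_log.mono fun x hx => ne_of_gt hx)).ordConnected.convex)).comp h
      (Real.exp_monotone.monotoneOn _)
  refine h2.congr fun x hx => ?_
  rw [Function.comp_apply, Real.rpow_def_of_pos hx, mul_comm]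

/-- Jensen's inequality for the powers with exponent `s ∉ (0, 1)`, which are convex. -/
lemma ofReal_sum_rpow_le {R : Type*} [Fintype R] {s : ℝ} (hs : 1 ≤ s ∨ s < 0) (w z : R → ℝ)
    (hw : ∀ r, 0 ≤ w r) (hw1 : ∑ r, w r = 1) (hz : ∀ r, 0 ≤ z r) :
    ENNReal.ofReal (∑ r, w r * z r) ^ s ≤
      ∑ r, ENNReal.ofReal (w r) * ENNReal.ofReal (z r) ^ s := by
  rcases hs with hs | hs
  · rw [ENNReal.ofReal_sum_of_nonneg fun r _ => mul_nonneg (hw r) (hz r)]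
    simp only [ENNReal.ofReal_mul (hw _)]
    refine ENNReal.rpow_arith_mean_le_arith_mean_rpow _ _ _ ?_ hs
    rw [← ENNReal.ofReal_sum_of_nonneg fun r _ => hw r, hw1, ENNReal.ofReal_one]
  -- In `ENNReal` a negative power of `0` is `⊤`. A vanishing `z r` of nonzero weight thus makes the
  -- right side infinite; otherwise all `z r` in the support of `w` are positive and real convexity
  -- applies there.
  · by_cases h0 : ∃ r, w r ≠ 0 ∧ z r = 0
    · obtain ⟨r, hwr, hzr⟩ := h0
      have : ∑ r, ENNReal.ofReal (w r) * ENNReal.ofReal (z r) ^ s = ⊤ := by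
        refine ENNReal.sum_eq_top.2 ⟨r, Finset.mem_univ r, ?_⟩
        rw [hzr, ENNReal.ofReal_zero, ENNReal.zero_rpow_of_neg hs, ENNReal.mul_top]
        simpa using lt_of_le_of_ne (hw r) hwr.symm
      rw [this]
      exact le_top
    push Not at h0
    let S : Finset R := Finset.univ.filter fun r => w r ≠ 0
    have hS : ∀ r ∈ S, 0 < z r := fun r hr =>
      lt_of_le_of_ne (hz r) (h0 r (by simpa [S] using hr)).symm
    have hS' : ∀ {f : R → ℝ}, ∑ r ∈ S, w r * f r = ∑ r, w r * f r := by
      intro f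
      refine Finset.sum_subset (Finset.subset_univ _) fun r _ hr => ?_
      have : w r = 0 := by simpa [S] using hr
      simp [this]
    have h1 : ∑ r ∈ S, w r = 1 := by
      simpa [hw1] using hS' (f := fun _ => 1)
    have hpos : 0 < ∑ r, w r * z r := by
      rw [← hS']
      refine Finset.sum_pos (fun r hr => mul_pos ?_ (hS r hr)) ?_
      · exact lt_of_le_of_ne (hw r) (Ne.symm (by simpa [S] using hr))
      · by_contra h
        rw [Finset.not_nonempty_iff_eq_empty] at h
        simp [h] at h1
    have hconv := (convexOn_rpow_of_neg hs).map_sum_le (t := S) (w := w) (p := z)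
      (fun r _ => hw r) h1 (fun r hr => hS r hr)
    simp only [smul_eq_mul] at hconv
    rw [ENNReal.ofReal_rpow_of_pos hpos]
    rw [hS'] at hconv
    refine (ENNReal.ofReal_le_ofReal hconv).trans ?_
    rw [ENNReal.ofReal_sum_of_nonneg fun r hr => mul_nonneg (hw r) (Real.rpow_nonneg (hz r) _)]
    refine (Finset.sum_le_sum fun r hr => ?_).trans
      (Finset.sum_le_sum_of_subset (Finset.subset_univ S))
    rw [ENNReal.ofReal_mul (hw r), ENNReal.ofReal_rpow_of_pos (hS r hr)]

/-! ### Moments of one Gaussian contraction -/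

/-- The moment of order `s` of the squared norm of a Gaussian vector whose coordinates have
variance `a ^ 2`. -/
noncomputable def chiSquareMoment (O : Type*) [Fintype O] (a s : ℝ) : ENNReal :=
  ∫⁻ g : O → ℝ, ENNReal.ofReal (∑ o, (a * g o) ^ 2) ^ s ∂Measure.pi fun _ => gaussianReal 0 1

/-- Needed for a zero input and negative `s`: the bound then reads `chiSquareMoment * ⊤`, which must
not collapse to `0`. -/
lemma chiSquareMoment_ne_zero_of_neg (O : Type*) [Fintype O] (a : ℝ) {s : ℝ} (hs : s < 0) :
    chiSquareMoment O a s ≠ 0 := by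
  intro h
  rw [chiSquareMoment, lintegral_eq_zero_iff (by fun_prop)] at h
  obtain ⟨g, hg⟩ := h.exists
  simp only [Pi.zero_apply, ENNReal.rpow_eq_zero_iff, ENNReal.ofReal_ne_top, false_and,
    or_false] at hg
  exact absurd hg.2 hs.not_gt

/-- Each slice `X r`, normalized by its squared norm `q r`, contributes a variable with the
chi-square law behind `chiSquareMoment O a`. The total is `Q` times their average with weights `q r
/ Q`, so Jensen bounds its moment without any independence between slices. -/
lemma lintegral_contract_rpow_le {O C K R : Type*} [Fintype O] [Fintype C] [Fintype K] [Fintype R]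
    (ι : O → C → K) (hι : Function.Injective (Function.uncurry ι)) (X : R → C → ℝ) (a : ℝ) {s : ℝ}
    (hs : 1 ≤ s ∨ s < 0) :
    ∫⁻ g : K → ℝ, ENNReal.ofReal (∑ r, ∑ o, (∑ c, a * g (ι o c) * X r c) ^ 2) ^ s
        ∂Measure.pi (fun _ => gaussianReal 0 1) ≤
      chiSquareMoment O a s * ENNReal.ofReal (∑ r, ∑ c, X r c ^ 2) ^ s := by
  set q : R → ℝ := fun r => ∑ c, X r c ^ 2 with hq
  have hq0 : ∀ r, 0 ≤ q r := fun r => Finset.sum_nonneg fun c _ => sq_nonneg _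
  have hqX : ∀ r, q r = 0 → ∀ c, X r c = 0 := fun r h c => by
    have := (Finset.sum_eq_zero_iff_of_nonneg fun c _ => sq_nonneg (X r c)).1 h c
      (Finset.mem_univ c)
    simpa using this
  set Q := ∑ r, q r with hQ
  have hQ0 : 0 ≤ Q := Finset.sum_nonneg fun r _ => hq0 r
  rcases hQ0.eq_or_lt with hQz | hQpos
  · have hX : ∀ r c, X r c = 0 := fun r c =>
      hqX r ((Finset.sum_eq_zero_iff_of_nonneg fun r _ => hq0 r).1 hQz.symm r
        (Finset.mem_univ r)) c
    have hi : ∀ g : K → ℝ, ∑ r, ∑ o, (∑ c, a * g (ι o c) * X r c) ^ 2 = 0 := fun g => by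
      simp [hX]
    simp only [hi, ← hQz]
    rcases hs with hs | hs
    · have : (0 : ENNReal) ^ s = 0 := ENNReal.zero_rpow_of_pos (by linarith)
      simp [this]
    · rw [ENNReal.ofReal_zero, ENNReal.zero_rpow_of_neg hs,
        ENNReal.mul_top (chiSquareMoment_ne_zero_of_neg O a hs)]
      exact le_top
  -- For `q r = 0` this is `0` by the division convention, and its negative power is `⊤`; the weight
  -- `q r / Q = 0` cancels that term.
  let z : R → (K → ℝ) → ℝ := fun r g => (∑ o, (∑ c, a * g (ι o c) * X r c) ^ 2) / q r
  have hz0 : ∀ r g, 0 ≤ z r g := fun r g =>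
    div_nonneg (Finset.sum_nonneg fun o _ => sq_nonneg _) (hq0 r)
  have hmeas : ∀ r, Measurable fun g => ENNReal.ofReal (z r g) ^ s := fun r => by
    simp only [z]; fun_prop
  have hint : ∀ r, q r ≠ 0 → ∫⁻ g, ENNReal.ofReal (z r g) ^ s
      ∂Measure.pi (fun _ => gaussianReal 0 1) = chiSquareMoment O a s := by
    intro r hr
    have hsq : √(q r) ^ 2 = q r := Real.sq_sqrt (hq0 r)
    have hlaw := map_sum_mul_pi_gaussianReal ι hι (fun c => X r c / √(q r)) (by
      simp only [div_pow, hsq, ← Finset.sum_div]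
      exact div_self hr)
    rw [chiSquareMoment, ← hlaw, lintegral_map (by fun_prop) (by fun_prop)]
    refine lintegral_congr fun g => ?_
    congr 2
    simp only [z, Finset.sum_div]
    refine Finset.sum_congr rfl fun o _ => ?_
    rw [← hsq, ← div_pow, Finset.sum_div, Finset.mul_sum]
    simp only [hsq]
    congr 1
    refine Finset.sum_congr rfl fun c _ => ?_
    ring
  have hsplit : ∀ g : K → ℝ, ∑ r, ∑ o, (∑ c, a * g (ι o c) * X r c) ^ 2 =
      Q * ∑ r, q r / Q * z r g := by
    intro g
    rw [Finset.mul_sum]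
    refine Finset.sum_congr rfl fun r _ => ?_
    by_cases hr : q r = 0
    · simp [hr, hqX r hr]
    · simp only [z]
      field_simp
  have hpt : ∀ g : K → ℝ, ENNReal.ofReal (∑ r, ∑ o, (∑ c, a * g (ι o c) * X r c) ^ 2) ^ s ≤
      ENNReal.ofReal Q ^ s * ∑ r, ENNReal.ofReal (q r / Q) * ENNReal.ofReal (z r g) ^ s := by
    intro g
    rw [hsplit, ENNReal.ofReal_mul hQ0, ENNReal.mul_rpow_of_ne_top ENNReal.ofReal_ne_top
      ENNReal.ofReal_ne_top]
    gcongr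
    refine ofReal_sum_rpow_le hs _ _ (fun r => div_nonneg (hq0 r) hQ0) ?_ fun r => hz0 r g
    rw [← Finset.sum_div, div_self hQpos.ne']
  refine (lintegral_mono hpt).trans ?_
  rw [lintegral_const_mul _ (by fun_prop), lintegral_finsetSum _ (by fun_prop), mul_comm]
  gcongr
  have hterm : ∀ r, ∫⁻ g, ENNReal.ofReal (q r / Q) * ENNReal.ofReal (z r g) ^ s
      ∂Measure.pi (fun _ => gaussianReal 0 1) =
        ENNReal.ofReal (q r / Q) * chiSquareMoment O a s := by
    intro r
    rw [lintegral_const_mul _ (hmeas r)]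
    by_cases hr : q r = 0
    · simp [hr]
    · rw [hint r hr]
  simp only [hterm]
  rw [← Finset.sum_mul, ← ENNReal.ofReal_sum_of_nonneg fun r _ => div_nonneg (hq0 r) hQ0,
    ← Finset.sum_div, div_self hQpos.ne', ENNReal.ofReal_one, one_mul]

/-! ### Chi-square moments through the Gamma function -/

lemma pi_gaussianReal_eq_withDensity (O : Type*) [Fintype O] :
    (Measure.pi fun _ : O => gaussianReal 0 1) =
      volume.withDensity fun g => ENNReal.ofReal (∏ o, gaussianPDFReal 0 1 (g o)) := by
  refine Measure.pi_eq fun s hs => ?_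
  have h0 : ∀ g : O → ℝ, 0 ≤ ∏ o, gaussianPDFReal 0 1 (g o) := fun g =>
    Finset.prod_nonneg fun o _ => gaussianPDFReal_nonneg _ _ _
  rw [withDensity_apply _ (MeasurableSet.univ_pi hs), volume_pi, Measure.restrict_pi_pi,
    ← ofReal_integral_eq_lintegral_ofReal]
  · rw [integral_fintype_prod_eq_prod (fun _ x => gaussianPDFReal 0 1 x),
      ENNReal.ofReal_prod_of_nonneg]
    · exact Finset.prod_congr rfl fun o _ => (gaussianReal_apply_eq_integral _ one_ne_zero _).symm
    · exact fun o _ => integral_nonneg fun x => gaussianPDFReal_nonneg _ _ _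
  · exact Integrable.fintype_prod_dep fun o => (integrable_gaussianPDFReal 0 1).restrict
  · exact Filter.Eventually.of_forall h0

lemma prod_gaussianPDFReal (O : Type*) [Fintype O] (g : O → ℝ) :
    ∏ o, gaussianPDFReal 0 1 (g o) =
      (√(2 * Real.pi))⁻¹ ^ Fintype.card O * Real.exp (-(1 / 2) * (∑ o, g o ^ 2)) := by
  simp only [gaussianPDFReal, Finset.prod_mul_distrib, ← Real.exp_sum]
  congr 1
  · simp
  · congr 1
    rw [Finset.mul_sum]
    exact Finset.sum_congr rfl fun o _ => by simp; ring

lemma lintegral_gaussian_radial (O : Type*) [Fintype O] {h : ℝ → ENNReal} (hh : Measurable h) :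
    ∫⁻ g : O → ℝ, h (∑ o, g o ^ 2) ∂Measure.pi (fun _ => gaussianReal 0 1) =
      ∫⁻ x : EuclideanSpace ℝ O, ENNReal.ofReal ((√(2 * Real.pi))⁻¹ ^ Fintype.card O *
        Real.exp (-(1 / 2) * ‖x‖ ^ 2)) * h (‖x‖ ^ 2) := by
  rw [pi_gaussianReal_eq_withDensity, lintegral_withDensity_eq_lintegral_mul _ (by
    simp only [prod_gaussianPDFReal]; fun_prop) (by fun_prop),
    ← (PiLp.volume_preserving_toLp O).lintegral_comp (by fun_prop)]
  refine lintegral_congr fun g => ?_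
  simp only [Pi.mul_apply, prod_gaussianPDFReal, EuclideanSpace.real_norm_sq_eq]

/-- Polar coordinates turn the moment into a one-dimensional Gamma integral, convergent for `s >
-card O / 2`. Only ratios of moments are used later, so `c` matters only in being independent of
`s`. -/
lemma exists_chiSquareMoment_eq (O : Type*) [Fintype O] [Nonempty O] {a : ℝ} (ha : 0 < a) :
    ∃ c : ℝ, 0 ≤ c ∧ ∀ s : ℝ, 0 < Fintype.card O / 2 + s →
      chiSquareMoment O a s =
        ENNReal.ofReal (c * (2 * a ^ 2) ^ s * Real.Gamma (Fintype.card O / 2 + s)) := by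
  set m := Fintype.card O with hm
  have hm1 : 1 ≤ m := Fintype.card_pos
  set k : ℝ := (√(2 * Real.pi))⁻¹ ^ m with hk
  have hk0 : 0 ≤ k := by positivity
  set V : ℝ := (volume : Measure (EuclideanSpace ℝ O)).real (Metric.ball 0 1) with hV
  refine ⟨m * V * k * (1 / 2) ^ (-(m : ℝ) / 2) * (1 / 2), by positivity, fun s hs => ?_⟩
  let f : ℝ → ℝ := fun y => k * (a ^ 2) ^ s * (y ^ (2 * s) * Real.exp (-(1 / 2) * y ^ (2 : ℝ)))
  have hf0 : ∀ x : EuclideanSpace ℝ O, 0 ≤ f ‖x‖ := fun x => by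
    simp only [f]; positivity
  have h1 : chiSquareMoment O a s = ∫⁻ x : EuclideanSpace ℝ O, ENNReal.ofReal (f ‖x‖) := by
    have hsum : ∀ g : O → ℝ, ∑ o, (a * g o) ^ 2 = a ^ 2 * ∑ o, g o ^ 2 := fun g => by
      simp only [mul_pow, Finset.mul_sum]
    simp only [chiSquareMoment, hsum]
    rw [lintegral_gaussian_radial O (h := fun t => ENNReal.ofReal (a ^ 2 * t) ^ s) (by fun_prop)]
    refine lintegral_congr_ae ?_
    -- The origin is discarded because extended and real powers of `0` differ for negative `s`.
    filter_upwards [Measure.ae_ne volume (0 : EuclideanSpace ℝ O)] with x hx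
    have hx' : 0 < ‖x‖ := norm_pos_iff.2 hx
    rw [ENNReal.ofReal_rpow_of_pos (by positivity), ← ENNReal.ofReal_mul (by positivity)]
    congr 1
    simp only [f]
    rw [Real.mul_rpow (by positivity) (by positivity), Real.rpow_mul hx'.le, Real.rpow_two]
    ring
  have hq : -1 < (m : ℝ) - 1 + 2 * s := by linarith
  have hpow : ∀ y ∈ Set.Ioi (0 : ℝ), y ^ (m - 1) • f y = k * (a ^ 2) ^ s *
      (y ^ ((m : ℝ) - 1 + 2 * s) * Real.exp (-(1 / 2) * y ^ (2 : ℝ))) := by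
    intro y hy
    rw [Real.rpow_add hy, show (m : ℝ) - 1 = ((m - 1 : ℕ) : ℝ) by push_cast [hm1]; ring,
      Real.rpow_natCast]
    simp only [f, smul_eq_mul]
    ring
  have hfin : Module.finrank ℝ (EuclideanSpace ℝ O) = m := by simp [hm]
  have hint : Integrable (fun x : EuclideanSpace ℝ O => f ‖x‖) := by
    rw [integrable_fun_norm_addHaar, hfin, integrableOn_congr_fun hpow measurableSet_Ioi]
    exact (integrableOn_rpow_mul_exp_neg_mul_rpow hq two_pos (by norm_num)).const_mul _
  rw [h1, ← ofReal_integral_eq_lintegral_ofReal hint (Filter.Eventually.of_forall hf0),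
    integral_fun_norm_addHaar volume f, hfin, setIntegral_congr_fun measurableSet_Ioi hpow,
    integral_const_mul, integral_rpow_mul_exp_neg_mul_rpow two_pos hq (by norm_num)]
  congr 1
  rw [show ((m : ℝ) - 1 + 2 * s + 1) / 2 = m / 2 + s by ring,
    show -((m : ℝ) - 1 + 2 * s + 1) / 2 = -(m : ℝ) / 2 + -s by ring,
    Real.rpow_add (by norm_num), Real.mul_rpow (by norm_num) (by positivity),
    show ((1 / 2 : ℝ)) ^ (-s) = 2 ^ s by
      rw [Real.rpow_neg (by norm_num), one_div, Real.inv_rpow (by norm_num), inv_inv]]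
  simp only [nsmul_eq_mul, smul_eq_mul, ← hV]
  ring

lemma chiSquareMoment_zero (O : Type*) [Fintype O] (a : ℝ) : chiSquareMoment O a 0 = 1 := by
  simp [chiSquareMoment]

/-- Recursion for the moments of a chi-square distribution. -/
lemma chiSquareMoment_add_one (O : Type*) [Fintype O] [Nonempty O] {a : ℝ} (ha : 0 < a) {s : ℝ}
    (hs : 0 < Fintype.card O / 2 + s) :
    chiSquareMoment O a (s + 1) =
      ENNReal.ofReal (a ^ 2 * (Fintype.card O + 2 * s)) * chiSquareMoment O a s := by
  obtain ⟨c, hc, h⟩ := exists_chiSquareMoment_eq O ha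
  rw [h s hs, h (s + 1) (by linarith), ← ENNReal.ofReal_mul]
  · congr 1
    rw [← add_assoc, Real.Gamma_add_one hs.ne', Real.rpow_add (by positivity), Real.rpow_one]
    ring
  · have : (0 : ℝ) < Fintype.card O + 2 * s := by linarith
    positivity

/-- Since `a ^ 2 = 1 / card O`, the recursion multiplies by `1 + 2 j / card O ≤ exp (2 j / card O)`
for `j < p`, and these exponents sum to at most `p ^ 2 / card O`. -/
lemma chiSquareMoment_natCast_le (O : Type*) [Fintype O] [Nonempty O] {a : ℝ} (ha : 0 < a)
    (ham : a ^ 2 * Fintype.card O = 1) (p : ℕ) :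
    chiSquareMoment O a p ≤ ENNReal.ofReal (Real.exp (a ^ 2 * p ^ 2)) := by
  induction p with
  | zero => simp [chiSquareMoment_zero]
  | succ p ih =>
    have hcard : (0 : ℝ) < Fintype.card O := Nat.cast_pos.2 Fintype.card_pos
    push_cast
    rw [chiSquareMoment_add_one O ha (by positivity)]
    refine (mul_le_mul_right ih _).trans ?_
    rw [← ENNReal.ofReal_mul (by positivity)]
    refine ENNReal.ofReal_le_ofReal ?_
    have h1 : a ^ 2 * (Fintype.card O + 2 * p) ≤ Real.exp (2 * a ^ 2 * p) := by
      have := Real.add_one_le_exp (2 * a ^ 2 * p)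
      linarith
    calc _ ≤ Real.exp (2 * a ^ 2 * p) * Real.exp (a ^ 2 * p ^ 2) := by gcongr
      _ = Real.exp (a ^ 2 * (p ^ 2 + 2 * p)) := by rw [← Real.exp_add]; ring_nf
      _ ≤ _ := by
        gcongr
        nlinarith

/-- The recursion run backwards gives factors `(1 - t)⁻¹`. The condition `4 * p ≤ card O` keeps `t ≤
1 / 2`, where `(1 - t)⁻¹ ≤ 1 + 2 * t ≤ exp (2 * t)`. -/
lemma chiSquareMoment_neg_natCast_le (O : Type*) [Fintype O] [Nonempty O] {a : ℝ} (ha : 0 < a)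
    (ham : a ^ 2 * Fintype.card O = 1) (p : ℕ) (hp : 4 * p ≤ Fintype.card O) :
    chiSquareMoment O a (-(p : ℝ)) ≤ ENNReal.ofReal (Real.exp (4 * (a ^ 2 * p ^ 2))) := by
  induction p with
  | zero => simp [chiSquareMoment_zero]
  | succ p ih =>
    have hp' : 4 * ((p : ℝ) + 1) ≤ Fintype.card O := by exact_mod_cast hp
    have hpos : (0 : ℝ) < Fintype.card O := Nat.cast_pos.2 Fintype.card_pos
    have ha2 : 0 < a ^ 2 := by positivity
    have hrec := chiSquareMoment_add_one O ha (s := -((p + 1 : ℕ) : ℝ)) (by push_cast; linarith)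
    rw [show -((p + 1 : ℕ) : ℝ) + 1 = -(p : ℝ) by push_cast; ring] at hrec
    set t : ℝ := 2 * a ^ 2 * (p + 1) with ht
    have ht1 : t ≤ 1 / 2 := by nlinarith
    have ht0 : 0 ≤ t := by positivity
    have hcoef : a ^ 2 * (Fintype.card O + 2 * -((p + 1 : ℕ) : ℝ)) = 1 - t := by
      push_cast; linarith
    rw [hcoef] at hrec
    have h1 : chiSquareMoment O a (-((p + 1 : ℕ) : ℝ)) =
        ENNReal.ofReal (1 - t)⁻¹ * chiSquareMoment O a (-(p : ℝ)) := by
      rw [hrec, ← mul_assoc, ← ENNReal.ofReal_mul (by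
        rw [inv_nonneg]; linarith), inv_mul_cancel₀ (by linarith), ENNReal.ofReal_one, one_mul]
    rw [h1]
    refine (mul_le_mul_right (ih (by omega)) _).trans ?_
    rw [← ENNReal.ofReal_mul (by rw [inv_nonneg]; linarith)]
    refine ENNReal.ofReal_le_ofReal ?_
    have h2 : (1 - t)⁻¹ ≤ Real.exp (2 * t) := by
      have h3 : (1 - t)⁻¹ ≤ 2 * t + 1 := by
        rw [inv_le_iff_one_le_mul₀ (by linarith)]
        nlinarith
      exact h3.trans (Real.add_one_le_exp _)
    calc _ ≤ Real.exp (2 * t) * Real.exp (4 * (a ^ 2 * p ^ 2)) := by gcongr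
      _ = Real.exp (4 * (a ^ 2 * (p ^ 2 + p + 1))) := by rw [← Real.exp_add, ht]; ring_nf
      _ ≤ _ := by
        gcongr
        push_cast
        nlinarith

/-! ### Partial sums over coordinates -/

section PartialSum

variable {E : Type*} [DecidableEq E] {X : E → Type*}

lemma DependsOn.apply_updateFinset {α : Type*} {F : (∀ e, X e) → α} {T : Set E}
    (hF : DependsOn F T) {S : Finset E} (h : ∀ e ∈ S, e ∉ T) (l : ∀ e, X e)
    (y : ∀ e : S, X e) : F (Function.updateFinset l S y) = F l := by
  refine hF fun e he => ?_
  have : e ∉ S := fun h' => h e h' he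
  simp [Function.updateFinset, this]

variable [∀ e, Fintype (X e)]

/-- The sum of `F` over the coordinates in `S`. -/
def partialSum (S : Finset E) (F : (∀ e, X e) → ℝ) (l : ∀ e, X e) : ℝ :=
  ∑ y : (∀ e : S, X e), F (Function.updateFinset l S y)

lemma partialSum_empty (F : (∀ e, X e) → ℝ) : partialSum ∅ F = F := by
  ext l
  simp [partialSum]

lemma partialSum_union {S T : Finset E} (h : Disjoint S T) (F : (∀ e, X e) → ℝ) :
    partialSum (S ∪ T) F = partialSum S (partialSum T F) := by
  ext l
  simp only [partialSum, Function.updateFinset_updateFinset h]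
  rw [← Fintype.sum_prod_type']
  exact (Fintype.sum_equiv (Equiv.piFinsetUnion X h) _ _ fun _ => rfl).symm

lemma partialSum_mul_left {G : (∀ e, X e) → ℝ} {T : Set E} (hG : DependsOn G T) {S : Finset E}
    (h : ∀ e ∈ S, e ∉ T) (F : (∀ e, X e) → ℝ) (l : ∀ e, X e) :
    partialSum S (fun l => G l * F l) l = G l * partialSum S F l := by
  simp only [partialSum, hG.apply_updateFinset h, Finset.mul_sum]

lemma DependsOn.partialSum {F : (∀ e, X e) → ℝ} {T : Set E} (hF : DependsOn F T) (S : Finset E) :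
    DependsOn (partialSum S F) (T \ S) := fun _ _ h =>
  Finset.sum_congr rfl fun y _ => hF.updateFinset y h

end PartialSum

/-! ### Moment propagation through a directed network -/

/-- A network of tensors without cycles, all of whose edges are directed towards a root: the tensor
at `v` has the single outgoing edge `out v`, and `con v` is the set of its other edges. -/
structure DirectedNetwork (V E : Type*) where
  con : V → Finset E
  out : V → E
  inp : Finset E
  depth : V → ℕ
  out_injective : Function.Injective out
  out_notMem_inp : ∀ v, out v ∉ inp
  con_disjoint : ∀ u v, u ≠ v → Disjoint (con u) (con v)
  depth_lt : ∀ u v, out u ∈ con v → depth v < depth u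
  con_cover : ∀ v, ∀ e ∈ con v, e ∈ inp ∨ ∃ u, out u = e

namespace DirectedNetwork

variable {V E : Type*} (N : DirectedNetwork V E)

lemma out_notMem_con (v : V) : N.out v ∉ N.con v := fun h => lt_irrefl _ (N.depth_lt _ _ h)

section Index

variable {N} {X : E → Type*} {K : V → Type*} {ι : ∀ v, (∀ e, X e) → K v}

/-- Here `hι` gives locality of the tensor index. Its other direction is used in
`lintegral_energy_insert_le`, to ensure that distinct labels address distinct Gaussian entries. -/
lemma dependsOn_index
    (hι : ∀ v l l', ι v l = ι v l' ↔ l (N.out v) = l' (N.out v) ∧ ∀ e ∈ N.con v, l e = l' e)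
    (v : V) : DependsOn (ι v) (insert (N.out v) (N.con v : Set E)) :=
  fun _ _ h => (hι _ _ _).2 ⟨h _ (Set.mem_insert _ _), fun _ he => h _ (Set.mem_insert_of_mem _ he)⟩

end Index

variable [DecidableEq E]

/-- The edges summed over when the tensors at `U` are applied. -/
def summed (U : Finset V) : Finset E := U.biUnion N.con

/-- The edges of the array that results when the tensors at `U` are applied to the input. -/
def present (U : Finset V) : Finset E := (N.inp ∪ U.image N.out) \ N.summed U

/-- The set `U` contains all vertices below each of its elements. -/
def DownClosed (U : Finset V) : Prop := ∀ u v, N.out u ∈ N.con v → v ∈ U → u ∈ U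

variable {X : E → Type*} [∀ e, Fintype (X e)] {K : V → Type*}

/-- The array that results when the tensors at `U`, scaled by `a`, are applied to the input `x`. -/
def state (a : ℝ) (ι : ∀ v, (∀ e, X e) → K v) (x : (∀ e, X e) → ℝ) (U : Finset V)
    (A : ∀ v, K v → ℝ) : (∀ e, X e) → ℝ :=
  partialSum (N.summed U) fun l => (∏ v ∈ U, a * A v (ι v l)) * x l

/-- The squared norm of `state`. -/
def energy (a : ℝ) (ι : ∀ v, (∀ e, X e) → K v) (x : (∀ e, X e) → ℝ) (l : ∀ e, X e) (U : Finset V)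
    (A : ∀ v, K v → ℝ) : ℝ :=
  partialSum (N.present U) (fun l => N.state a ι x U A l ^ 2) l

variable {N} {a : ℝ} {ι : ∀ v, (∀ e, X e) → K v} {x : (∀ e, X e) → ℝ}

lemma measurable_energy (l : ∀ e, X e) (U : Finset V) :
    Measurable (N.energy a ι x l U) := by
  unfold energy state partialSum
  fun_prop

section Step

variable (hι : ∀ v l l', ι v l = ι v l' ↔ l (N.out v) = l' (N.out v) ∧ ∀ e ∈ N.con v, l e = l' e)

include hι in
lemma dependsOn_state (hx : DependsOn x N.inp) (U : Finset V) (A : ∀ v, K v → ℝ) :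
    DependsOn (N.state a ι x U A) (N.present U) := by
  have h : DependsOn (fun l => (∏ v ∈ U, a * A v (ι v l)) * x l)
      (N.inp ∪ U.image N.out ∪ N.summed U : Set E) := by
    intro l l' hl
    have h1 : x l = x l' := hx fun e he => hl e (Or.inl (Or.inl he))
    have h2 : ∀ v ∈ U, ι v l = ι v l' := fun v hv => by
      refine dependsOn_index hι v fun e he => hl e ?_
      rcases he with rfl | he
      · exact Or.inl (Or.inr (by simpa using ⟨v, hv, rfl⟩))
      · exact Or.inr (by simpa [summed] using ⟨v, hv, he⟩)
    simp only [h1]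
    congr 1
    exact Finset.prod_congr rfl fun v hv => by rw [h2 v hv]
  refine (h.partialSum (N.summed U)).mono fun e he => ?_
  simp only [present, Finset.coe_sdiff, Finset.coe_union]
  rcases he with ⟨he | he, he'⟩
  · exact ⟨he, he'⟩
  · exact absurd he he'

variable {U : Finset V} {v : V}

lemma con_disjoint_summed (hv : v ∉ U) : Disjoint (N.con v) (N.summed U) :=
  (Finset.disjoint_biUnion_right _ _ _).2 fun u hu =>
    N.con_disjoint v u fun h => hv (h ▸ hu)

lemma out_notMem_summed (hd : ∀ u ∈ U, N.depth v ≤ N.depth u) : N.out v ∉ N.summed U := by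
  intro h
  obtain ⟨u, hu, h⟩ := Finset.mem_biUnion.1 h
  exact absurd (N.depth_lt _ _ h) (hd u hu).not_gt

lemma out_notMem_present (hv : v ∉ U) : N.out v ∉ N.present U := by
  intro h
  rcases Finset.mem_union.1 (Finset.mem_sdiff.1 h).1 with h | h
  · exact N.out_notMem_inp v h
  · obtain ⟨u, hu, h⟩ := Finset.mem_image.1 h
    exact hv (N.out_injective h ▸ hu)

variable [DecidableEq V]

/-- Down-closedness ensures that each edge contracted at `v` is an input or leaves a tensor already
applied; disjointness of the sets `con` ensures that it has not been summed yet. -/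
lemma con_subset_present (hv : v ∉ U) (hU : N.DownClosed (insert v U)) :
    N.con v ⊆ N.present U := by
  intro e he
  refine Finset.mem_sdiff.2 ⟨Finset.mem_union.2 ?_,
    Finset.disjoint_left.1 (con_disjoint_summed hv) he⟩
  rcases N.con_cover v e he with h | ⟨u, rfl⟩
  · exact Or.inl h
  · refine Or.inr (Finset.mem_image_of_mem _ ?_)
    rcases Finset.mem_insert.1 (hU u v he (Finset.mem_insert_self _ _)) with rfl | h
    · exact absurd he (N.out_notMem_con _)
    · exact h

lemma present_insert (hd : ∀ u ∈ U, N.depth v ≤ N.depth u) :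
    N.present (insert v U) = (N.present U \ N.con v) ∪ {N.out v} := by
  have h1 := out_notMem_summed hd
  have h2 := N.out_notMem_con v
  ext e
  have h3 : e ∈ N.summed (insert v U) ↔ e ∈ N.con v ∨ e ∈ N.summed U := by
    simp [summed]
  simp only [present, Finset.mem_sdiff, Finset.mem_union, Finset.image_insert, Finset.mem_insert,
    Finset.mem_singleton, h3]
  by_cases he : e = N.out v
  · subst he; simp [h1, h2]
  · simp only [he, false_or, or_false]; tauto

-- The factor at `v` can be taken out of the sum over earlier edges: its contracted edges are not
-- among them by disjointness, nor is its outgoing edge, because `v` has minimal depth.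
include hι in
lemma state_insert (hv : v ∉ U) (hd : ∀ u ∈ U, N.depth v ≤ N.depth u) (A : ∀ v, K v → ℝ) :
    N.state a ι x (insert v U) A =
      partialSum (N.con v) fun l => a * A v (ι v l) * N.state a ι x U A l := by
  have h1 : N.summed (insert v U) = N.con v ∪ N.summed U := by simp [summed]
  rw [state, h1, partialSum_union (con_disjoint_summed hv)]
  congr 1
  ext l
  have h2 : DependsOn (fun l => a * A v (ι v l)) (insert (N.out v) (N.con v : Set E)) :=
    fun l l' h => by simp only [dependsOn_index hι v h]
  simp only [Finset.prod_insert hv, mul_assoc (a * A v _)]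
  refine partialSum_mul_left h2 (fun e he he' => ?_) _ _
  rcases he' with rfl | he'
  · exact out_notMem_summed hd he
  · exact Finset.disjoint_left.1 (con_disjoint_summed hv) he' he

-- With the other tensors frozen this is `lintegral_contract_rpow_le`: rows `o` run over the
-- outgoing edge, columns `c` over the edges contracted at `v`, and slices `r` over the present
-- edges that `v` does not touch.
include hι in
lemma lintegral_energy_insert_le [∀ v, Fintype (K v)] (hx : DependsOn x N.inp) {s : ℝ}
    (hs : 1 ≤ s ∨ s < 0) (hv : v ∉ U) (hd : ∀ u ∈ U, N.depth v ≤ N.depth u)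
    (hU : N.DownClosed (insert v U)) (l : ∀ e, X e) (A : ∀ v, K v → ℝ) :
    ∫⁻ g, ENNReal.ofReal (N.energy a ι x l (insert v U) (Function.update A v g)) ^ s
        ∂Measure.pi (fun _ : K v => gaussianReal 0 1) ≤
      chiSquareMoment (∀ e : ({N.out v} : Finset E), X e) a s *
        ENNReal.ofReal (N.energy a ι x l U A) ^ s := by
  set R := N.present U \ N.con v with hR
  have hcU := con_subset_present hv hU
  have hpU : N.present U = R ∪ N.con v := (Finset.sdiff_union_of_subset hcU).symm
  have hRo : Disjoint R {N.out v} := Finset.disjoint_singleton_right.2 fun h =>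
    out_notMem_present hv (Finset.mem_sdiff.1 h).1
  have hRc : Disjoint R (N.con v) := Finset.sdiff_disjoint
  have hstate : ∀ g, N.state a ι x U (Function.update A v g) = N.state a ι x U A := by
    intro g
    unfold state
    congr 1
    ext l
    congr 1
    refine Finset.prod_congr rfl fun u hu => ?_
    rw [Function.update_of_ne]
    rintro rfl
    exact hv hu
  let up := fun (l : ∀ e, X e) (S : Finset E) (y : ∀ e : S, X e) => Function.updateFinset l S y
  let ι' : (∀ e : ({N.out v} : Finset E), X e) → (∀ e : N.con v, X e) → K v :=
    fun o c => ι v (up (up l {N.out v} o) (N.con v) c)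
  let Y : (∀ e : R, X e) → (∀ e : N.con v, X e) → ℝ :=
    fun r c => N.state a ι x U A (up (up l R r) (N.con v) c)
  have h1 : ∀ g, N.energy a ι x l (insert v U) (Function.update A v g) =
      ∑ r, ∑ o, (∑ c, a * g (ι' o c) * Y r c) ^ 2 := by
    intro g
    rw [energy, present_insert hd, partialSum_union hRo, state_insert hι hv hd, hstate]
    simp only [partialSum, Function.update_self]
    refine Finset.sum_congr rfl fun r _ => Finset.sum_congr rfl fun o _ => ?_
    congr 1
    refine Finset.sum_congr rfl fun c _ => ?_
    have e1 : ι v (up (up (up l R r) {N.out v} o) (N.con v) c) = ι' o c := by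
      refine dependsOn_index hι v fun e he => ?_
      rcases he with rfl | he
      · simp [up, Function.updateFinset, N.out_notMem_con v]
      · have he' : e ∈ N.con v := he
        simp [up, Function.updateFinset, he']
    have e2 : N.state a ι x U A (up (up (up l R r) {N.out v} o) (N.con v) c) = Y r c := by
      refine dependsOn_state hι hx U A fun e he => ?_
      have : e ≠ N.out v := fun h => out_notMem_present hv (h ▸ he)
      simp [up, Function.updateFinset, this]
    rw [← e1, ← e2]
  have h2 : N.energy a ι x l U A = ∑ r, ∑ c, Y r c ^ 2 := by
    rw [energy, hpU, partialSum_union hRc]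
    rfl
  have hinj : Function.Injective (Function.uncurry ι') := by
    rintro ⟨o, c⟩ ⟨o', c'⟩ h
    obtain ⟨ho, hc⟩ := (hι _ _ _).1 h
    refine Prod.ext (funext fun ⟨e, he⟩ => ?_) (funext fun ⟨e, he⟩ => ?_)
    · obtain rfl := Finset.mem_singleton.1 he
      simpa [up, Function.updateFinset, N.out_notMem_con v] using ho
    · simpa [up, Function.updateFinset, he] using hc e he
  simp only [h1, h2]
  exact lintegral_contract_rpow_le ι' hinj Y a hs

include hι in
/-- The moment bound for a network of Gaussian tensors, by induction along the network. -/
lemma lmarginal_energy_le [∀ v, Fintype (K v)] (hx : DependsOn x N.inp) {s : ℝ}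
    (hs : 1 ≤ s ∨ s < 0) {κ : ENNReal}
    (hκ : ∀ v, chiSquareMoment (∀ e : ({N.out v} : Finset E), X e) a s ≤ κ)
    (l : ∀ e, X e) (U : Finset V) (hU : N.DownClosed U) (A : ∀ v, K v → ℝ) :
    lmarginal (fun v => Measure.pi fun _ : K v => gaussianReal 0 1) U
        (fun A => ENNReal.ofReal (N.energy a ι x l U A) ^ s) A ≤
      κ ^ U.card * ENNReal.ofReal (partialSum N.inp (fun l => x l ^ 2) l) ^ s := by
  induction hn : U.card generalizing U A with
  | zero =>
    obtain rfl := Finset.card_eq_zero.1 hn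
    simp [energy, present, summed, state, partialSum_empty]
  | succ n ih =>
    -- A vertex of minimal depth is applied last, so its tensor is integrated first, with the
    -- tensors below it fixed; removing it keeps `U` down-closed.
    obtain ⟨v, hvU, hmin⟩ := U.exists_min_image N.depth (Finset.card_pos.1 (by omega))
    have hv := Finset.notMem_erase v U
    have hins := Finset.insert_erase hvU
    have hd : ∀ u ∈ U.erase v, N.depth v ≤ N.depth u := fun u hu =>
      hmin u (Finset.mem_of_mem_erase hu)
    have hdc : N.DownClosed (U.erase v) := fun u w h hw => by
      refine Finset.mem_erase.2 ⟨?_, hU u w h (Finset.mem_of_mem_erase hw)⟩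
      rintro rfl
      exact absurd (N.depth_lt _ _ h) (hd w hw).not_gt
    have hm : Measurable fun A => ENNReal.ofReal (N.energy a ι x l U A) ^ s :=
      (measurable_energy l U).ennreal_ofReal.pow_const s
    rw [lmarginal_erase' _ hm hvU]
    have hstep : (fun A => ∫⁻ g, ENNReal.ofReal (N.energy a ι x l U (Function.update A v g)) ^ s
        ∂Measure.pi fun _ : K v => gaussianReal 0 1) ≤
        fun A => κ * ENNReal.ofReal (N.energy a ι x l (U.erase v) A) ^ s := by
      intro A
      have := lintegral_energy_insert_le (a := a) hι hx hs hv hd (hins.symm ▸ hU) l A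
      rw [hins] at this
      exact this.trans (mul_le_mul_left (hκ v) _)
    refine (lmarginal_mono hstep A).trans ?_
    have hm' : Measurable fun A => ENNReal.ofReal (N.energy a ι x l (U.erase v) A) ^ s :=
      (measurable_energy l _).ennreal_ofReal.pow_const s
    have hc : lmarginal (fun v => Measure.pi fun _ : K v => gaussianReal 0 1) (U.erase v)
        (fun A => κ * ENNReal.ofReal (N.energy a ι x l (U.erase v) A) ^ s) A =
        κ * lmarginal (fun v => Measure.pi fun _ : K v => gaussianReal 0 1) (U.erase v)
          (fun A => ENNReal.ofReal (N.energy a ι x l (U.erase v) A) ^ s) A :=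
      lintegral_const_mul _ (hm'.comp measurable_updateFinset)
    rw [hc, pow_succ', mul_assoc]
    gcongr
    exact ih _ hdc A (by rw [Finset.card_erase_of_mem hvU]; omega)

end Step

end DirectedNetwork

/-! ### Concentration from moment bounds -/

lemma Real.exp_half_le_one_add {ε : ℝ} (h0 : 0 ≤ ε) (h1 : ε ≤ 1) : Real.exp (ε / 2) ≤ 1 + ε := by
  have h := Real.exp_bound_div_one_sub_of_interval (x := ε / 2) (by linarith) (by linarith)
  refine h.trans ?_
  rw [div_le_iff₀ (by linarith)]
  nlinarith

/-- Markov's inequality for the positive and negative moments of order `p`. -/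
lemma measureReal_abs_sub_one_le {Ω : Type*} [MeasurableSpace Ω] (P : Measure Ω)
    [IsProbabilityMeasure P] {Y : Ω → ℝ} (hY : Measurable Y) {ε B : ℝ} (hε : 0 < ε) (hε1 : ε ≤ 1)
    (hB : 0 ≤ B) {p : ℕ}
    (hup : ∫⁻ ω, ENNReal.ofReal (Y ω) ^ (p : ℝ) ∂P ≤ ENNReal.ofReal B)
    (hlow : ∫⁻ ω, ENNReal.ofReal (Y ω) ^ (-(p : ℝ)) ∂P ≤ ENNReal.ofReal B) :
    P.real {ω | ε < |Y ω - 1|} ≤ 2 * (B * Real.exp (-(p * ε / 2))) := by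
  -- One threshold serves both tails: `Y > 1 + ε` forces `Y ≥ exp (ε / 2)`, and `Y < 1 - ε` forces
  -- `Y ≤ exp (-ε / 2)`.
  set c : ENNReal := ENNReal.ofReal (Real.exp (p * ε / 2)) with hc
  have hc0 : c ≠ 0 := by simp [hc, Real.exp_pos]
  have hmarkov : ∀ s : ℝ, ∫⁻ ω, ENNReal.ofReal (Y ω) ^ s ∂P ≤ ENNReal.ofReal B →
      P.real {ω | c ≤ ENNReal.ofReal (Y ω) ^ s} ≤ B * Real.exp (-(p * ε / 2)) := by
    intro s hs
    have h := meas_ge_le_lintegral_div (μ := P) (f := fun ω => ENNReal.ofReal (Y ω) ^ s)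
      (by fun_prop) hc0 ENNReal.ofReal_ne_top
    refine ENNReal.toReal_le_of_le_ofReal (by positivity) (h.trans ?_)
    rw [Real.exp_neg, ← div_eq_mul_inv, ENNReal.ofReal_div_of_pos (Real.exp_pos _)]
    exact ENNReal.div_le_div_right hs _
  have hsub : {ω | ε < |Y ω - 1|} ⊆ {ω | c ≤ ENNReal.ofReal (Y ω) ^ (p : ℝ)} ∪
      {ω | c ≤ ENNReal.ofReal (Y ω) ^ (-(p : ℝ))} := by
    intro ω hω
    rcases lt_abs.1 (show ε < |Y ω - 1| from hω) with h | h
    · left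
      have h1 : Real.exp (ε / 2) ≤ Y ω := by
        linarith [Real.exp_half_le_one_add hε.le hε1]
      have h2 : c = ENNReal.ofReal (Real.exp (ε / 2)) ^ (p : ℝ) := by
        rw [hc, ENNReal.rpow_natCast, ← ENNReal.ofReal_pow (Real.exp_pos _).le, ← Real.exp_nat_mul]
        ring_nf
      rw [Set.mem_ofPred_eq, h2]
      gcongr
    · right
      have h1 : Y ω ≤ Real.exp (-(ε / 2)) := by
        linarith [Real.add_one_le_exp (-(ε / 2))]
      have h2 : c = (ENNReal.ofReal (Real.exp (-(ε / 2))) ^ (p : ℝ))⁻¹ := by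
        rw [hc, ENNReal.rpow_natCast, ← ENNReal.ofReal_pow (Real.exp_pos _).le, ← Real.exp_nat_mul,
          ← ENNReal.ofReal_inv_of_pos (Real.exp_pos _), ← Real.exp_neg]
        ring_nf
      rw [Set.mem_ofPred_eq, h2, ENNReal.rpow_neg]
      gcongr
  calc P.real {ω | ε < |Y ω - 1|} ≤ _ := measureReal_mono hsub
    _ ≤ _ := measureReal_union_le _ _
    _ ≤ _ := by linarith [hmarkov _ hup, hmarkov _ hlow]

/-- A product of `n` factors whose moments are those of normalized chi-square variables with `m`
degrees of freedom is concentrated around `1`. -/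
lemma measureReal_abs_sub_one_lt {Ω : Type*} [MeasurableSpace Ω] (P : Measure Ω)
    [IsProbabilityMeasure P] {Y : Ω → ℝ} (hY : Measurable Y) {ε δ δ₀ : ℝ} (hε : 0 < ε)
    (hε1 : ε ≤ 1) (hδ : 0 < δ) (hδδ₀ : δ ≤ δ₀) (hδ₀ : δ₀ < 1) {n m : ℕ} (hn : 1 ≤ n)
    (hm : 128 * (1 + 1 / Real.log (1 / δ₀)) * (n * Real.log (1 / δ) / ε ^ 2) ≤ m)
    (hup : ∀ p : ℕ, 1 ≤ p → ∫⁻ ω, ENNReal.ofReal (Y ω) ^ (p : ℝ) ∂P ≤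
      ENNReal.ofReal (Real.exp (p ^ 2 / m)) ^ n)
    (hlow : ∀ p : ℕ, 1 ≤ p → 4 * p ≤ m → ∫⁻ ω, ENNReal.ofReal (Y ω) ^ (-(p : ℝ)) ∂P ≤
      ENNReal.ofReal (Real.exp (4 * (p ^ 2 / m))) ^ n) :
    P.real {ω | ε < |Y ω - 1|} < δ := by
  set L := Real.log (1 / δ) with hL
  have hL0 : 0 < Real.log (1 / δ₀) :=
    Real.log_pos (by rw [one_lt_div (hδ.trans_le hδδ₀)]; exact hδ₀)
  have hLL : Real.log (1 / δ₀) ≤ L :=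
    Real.log_le_log (one_div_pos.2 (hδ.trans_le hδδ₀)) (one_div_le_one_div_of_le hδ hδδ₀)
  have hLpos : 0 < L := hL0.trans_le hLL
  have hn1 : (1 : ℝ) ≤ n := by exact_mod_cast hn
  have hkey : 128 * n * (L + 1) ≤ m * ε ^ 2 := by
    -- The dependence on `δ₀` arises here: `L` is bounded below by `log (1 / δ₀)`, so the additive
    -- `1` is absorbed into a multiple of `L`.
    have h1 : L + 1 ≤ (1 + 1 / Real.log (1 / δ₀)) * L := by
      have : 1 ≤ 1 / Real.log (1 / δ₀) * L := by
        rw [one_div_mul_eq_div, one_le_div hL0]; exact hLL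
      linarith
    have h2 : 128 * (1 + 1 / Real.log (1 / δ₀)) * (n * L) ≤ m * ε ^ 2 := by
      rw [← div_le_iff₀ (by positivity), ← mul_div_assoc] at *
      exact hm
    calc 128 * n * (L + 1) ≤ 128 * n * ((1 + 1 / Real.log (1 / δ₀)) * L) := by gcongr
      _ ≤ _ := by linarith
  have hmε : m * ε ^ 2 ≤ m * ε := by
    have : ε ^ 2 ≤ ε := by nlinarith
    gcongr
  have hm0 : (0 : ℝ) < m := by
    by_contra h
    have : (m : ℝ) = 0 := le_antisymm (not_lt.1 h) m.cast_nonneg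
    rw [this] at hkey
    nlinarith
  -- For `p ≤ t` the moment exponent `4 n p² / m` is at most `p ε / 4`, half of the Markov gain `p ε
  -- / 2`. Rounding down costs at most a factor `2`, so `p ε / 4 ≥ m ε² / (128 n)`, whence the
  -- constant `128`.
  set t : ℝ := m * ε / (16 * n) with ht
  have ht2 : 2 ≤ t := by
    rw [ht, le_div_iff₀ (by positivity)]
    nlinarith
  set p := ⌊t⌋₊ with hp
  have hpt : (p : ℝ) ≤ t := Nat.floor_le (by linarith)
  have htp : t / 2 ≤ p := by
    have := (Nat.lt_floor_add_one t).le
    linarith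
  have hp1 : 1 ≤ p := Nat.le_floor (by push_cast; linarith)
  have hptn : 16 * n * p ≤ m * ε := by
    rw [ht, le_div_iff₀ (by positivity)] at hpt
    linarith
  have hpm : 4 * p ≤ m := by
    have : (4 * p : ℝ) ≤ m := by nlinarith [m.cast_nonneg (α := ℝ), p.cast_nonneg (α := ℝ)]
    exact_mod_cast this
  have hB : ∀ c : ℝ, c ≤ 4 → ENNReal.ofReal (Real.exp (c * (p ^ 2 / m))) ^ n ≤
      ENNReal.ofReal (Real.exp (p * ε / 4)) := by
    intro c hc
    rw [← ENNReal.ofReal_pow (Real.exp_pos _).le, ← Real.exp_nat_mul]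
    refine ENNReal.ofReal_le_ofReal (Real.exp_le_exp.2 ?_)
    calc (n : ℝ) * (c * ((p : ℝ) ^ 2 / m)) ≤ n * (4 * ((p : ℝ) ^ 2 / m)) := by gcongr
      _ = 16 * n * p * ((p : ℝ) / 4) / m := by ring
      _ ≤ m * ε * (p / 4) / m := by gcongr
      _ = p * ε / 4 := by field_simp
  have h := measureReal_abs_sub_one_le P hY hε hε1 (Real.exp_pos _).le
    ((hup p hp1).trans (by simpa using hB 1 (by norm_num))) ((hlow p hp1 hpm).trans (hB 4 le_rfl))
  refine h.trans_lt ?_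
  rw [← Real.exp_add]
  have hexp : p * ε / 4 + -(p * ε / 2) ≤ -(L + 1) := by
    have h1 : 4 * (L + 1) ≤ t / 2 * ε := by
      rw [ht, div_div, div_mul_eq_mul_div, le_div_iff₀ (by positivity)]
      linarith
    nlinarith
  have hδL : Real.exp (-L) = δ := by
    rw [hL, one_div, Real.log_inv, neg_neg, Real.exp_log hδ]
  -- The spare `1` in the exponent beats the factor `2` of the union bound, since `2 / e < 1`.
  calc 2 * Real.exp (p * ε / 4 + -(p * ε / 2)) ≤ 2 * Real.exp (-(L + 1)) := by gcongr
    _ = 2 * Real.exp (-1) * δ := by rw [neg_add, Real.exp_add, hδL]; ring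
    _ < 1 * δ := by
      gcongr
      rw [Real.exp_neg, ← div_eq_mul_inv, div_lt_one (Real.exp_pos _)]
      linarith [Real.exp_one_gt_d9]
    _ = δ := one_mul δ

/-! ### Paths and rooted trees -/

namespace SimpleGraph

lemma isTree_pathGraph (n : ℕ) : (pathGraph (n + 1)).IsTree := by
  rw [isTree_iff_connected_and_card]
  refine ⟨pathGraph_connected n, le_antisymm ?_
    (pathGraph_connected n).card_vert_le_card_edgeSet_add_one⟩
  rw [Nat.card_fin]
  refine Nat.succ_le_succ ?_
  let f : Fin n → (pathGraph (n + 1)).edgeSet := fun i =>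
    ⟨s(i.castSucc, i.succ), by simp [pathGraph_adj]⟩
  have hf : Function.Surjective f := by
    rintro ⟨e, he⟩
    induction e using Sym2.ind with
    | _ u v =>
      have h : u.val + 1 = v.val ∨ v.val + 1 = u.val := pathGraph_adj.1 he
      rcases h with h | h
      · refine ⟨⟨u, by omega⟩, Subtype.ext ?_⟩
        exact congrArg₂ (fun a b => s(a, b)) (Fin.ext rfl) (Fin.ext h)
      · refine ⟨⟨v, by omega⟩, Subtype.ext ?_⟩
        exact (congrArg₂ (fun a b => s(a, b)) (Fin.ext rfl) (Fin.ext h)).trans Sym2.eq_swap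
  simpa using Nat.card_le_card_of_surjective f hf

variable {V : Type*} {G : SimpleGraph V}

lemma Connected.exists_adj_dist_lt (hG : G.Connected) {r v : V} (h : v ≠ r) :
    ∃ w, G.Adj v w ∧ G.dist r w < G.dist r v := by
  obtain ⟨p, hp⟩ := (hG v r).exists_walk_length_eq_dist
  cases p with
  | nil => exact absurd rfl h
  | @cons _ w _ hadj q =>
    refine ⟨w, hadj, ?_⟩
    have h1 := G.dist_le q
    rw [dist_comm, dist_comm (u := r) (v := v), ← hp, Walk.length_cons]
    omega

/-- A shortest path from a closer neighbor to `r` avoids `v`, so it extends to a path from `v`.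
Uniqueness of paths in a tree fixes its second vertex. -/
lemma IsTree.eq_of_adj_of_dist_lt (hG : G.IsTree) {r v w w' : V} (hw : G.Adj v w)
    (hd : G.dist r w < G.dist r v) (hw' : G.Adj v w') (hd' : G.dist r w' < G.dist r v) :
    w = w' := by
  classical
  have key : ∀ u, G.Adj v u → G.dist r u < G.dist r v →
      ∃ p : G.Walk v r, p.IsPath ∧ p.snd = u := by
    intro u hu hd
    obtain ⟨q, hq, hql⟩ := (hG.connected u r).exists_path_of_dist
    refine ⟨.cons hu q, (Walk.cons_isPath_iff _ _).2 ⟨hq, fun hv => ?_⟩, by simp⟩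
    have h1 := G.dist_le (q.dropUntil v hv)
    have h2 := q.length_dropUntil_le_length hv
    rw [dist_comm] at h1
    rw [dist_comm] at hql
    omega
  obtain ⟨p, hp, rfl⟩ := key w hw hd
  obtain ⟨p', hp', rfl⟩ := key w' hw' hd'
  rw [(hG.existsUnique_path v r).unique hp hp']

end SimpleGraph

/-! ### Row sizes and the orientation towards the output -/

namespace TensorNetworkEmbedding

variable {V I O : Type*} (T : TensorNetworkEmbedding V I O)

lemma IsTensorTrain.isTree [Fintype V] [Nonempty V] (h : T.IsTensorTrain) : T.graph.IsTree := by
  obtain ⟨-, f, -⟩ := h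
  obtain ⟨n, hn⟩ := Nat.exists_eq_succ_of_ne_zero (Fintype.card_ne_zero (α := V))
  rw [f.isTree_iff, hn]
  exact SimpleGraph.isTree_pathGraph n

-- Each bond is counted exactly once, at whichever end comes earlier in `σ`, so the product forgets
-- the ordering.
open Classical in
lemma prod_rowSize [Fintype V] [Fintype O] (σ : V ≃ Fin (Fintype.card V)) :
    ∏ v, T.rowSize σ v = (∏ o, T.outDim o) * ∏ e, T.bondDim e := by
  simp only [rowSize, Finset.prod_mul_distrib]
  congr 1
  · exact Finset.prod_fiberwise _ _ _
  · simp only [Finset.prod_filter]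
    rw [Finset.prod_comm]
    refine Finset.prod_congr rfl fun ⟨e, he⟩ _ => ?_
    induction e using Sym2.ind with
    | _ a b =>
      have hab : a ≠ b := T.graph.ne_of_adj he
      have key : ∀ a b, ∀ he : s(a, b) ∈ T.graph.edgeSet, σ a < σ b →
          (∏ v, if ∃ u, s(a, b) = s(v, u) ∧ σ v < σ u then T.bondDim ⟨s(a, b), he⟩ else 1) =
            T.bondDim ⟨s(a, b), he⟩ := by
        intro a b he hlt
        rw [Finset.prod_eq_single a]
        · rw [if_pos ⟨b, rfl, hlt⟩]
        · intro v _ hv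
          rw [if_neg]
          rintro ⟨u, h, hlt'⟩
          rcases Sym2.eq_iff.1 h with ⟨rfl, rfl⟩ | ⟨rfl, rfl⟩
          · exact hv rfl
          · exact lt_asymm hlt hlt'
        · simp
      rcases lt_or_gt_of_ne (σ.injective.ne hab) with h | h
      · exact key a b he h
      · have h2 := key b a (Sym2.eq_swap ▸ he) h
        simpa only [Sym2.eq_swap (a := b) (b := a)] using h2

lemma prod_rowSize_eq_pow [Fintype V] [Fintype O] (σ : V ≃ Fin (Fintype.card V))
    (hT : T.graph.IsTree) {m : ℕ} (hO : Fintype.card O = 1) (ho : ∀ o, T.outDim o = m)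
    (hb : ∀ e, T.bondDim e = m) : ∏ v, T.rowSize σ v = m ^ Fintype.card V := by
  classical
  rw [prod_rowSize]
  simp only [ho, hb, Finset.prod_const, Finset.card_univ, hO]
  rw [← hT.card_edgeFinset, ← SimpleGraph.edgeFinset_card, add_comm, pow_add]

section Directed

open Classical in
/-- The neighbor of `v` that is closer to `r`. -/
noncomputable def parent (hT : T.graph.IsTree) (r v : V) : V :=
  if h : v ≠ r then (hT.connected.exists_adj_dist_lt h).choose else v

variable {T}

lemma adj_parent (hT : T.graph.IsTree) {r v : V} (h : v ≠ r) :
    T.graph.Adj v (T.parent hT r v) := by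
  rw [parent, dif_pos h]
  exact (hT.connected.exists_adj_dist_lt h).choose_spec.1

lemma dist_parent_lt (hT : T.graph.IsTree) {r v : V} (h : v ≠ r) :
    T.graph.dist r (T.parent hT r v) < T.graph.dist r v := by
  rw [parent, dif_pos h]
  exact (hT.connected.exists_adj_dist_lt h).choose_spec.2

lemma parent_eq (hT : T.graph.IsTree) {r v w : V} (hw : T.graph.Adj v w)
    (hd : T.graph.dist r w < T.graph.dist r v) : v ≠ r ∧ T.parent hT r v = w := by
  have h : v ≠ r := by
    rintro rfl
    simp at hd
  exact ⟨h, hT.eq_of_adj_of_dist_lt (adj_parent hT h) (dist_parent_lt hT h) hw hd⟩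

variable (T)

open Classical in
/-- The edge at `v` that leads towards the output dimension `o`. -/
noncomputable def outEdge (hT : T.graph.IsTree) (o : O) (v : V) : T.Edge :=
  if h : v = T.outVertex o then Sum.inr (Sum.inr o)
  else Sum.inl ⟨s(v, T.parent hT (T.outVertex o) v), adj_parent hT h⟩

variable {T}

lemma outEdge_outVertex (hT : T.graph.IsTree) (o : O) :
    T.outEdge hT o (T.outVertex o) = Sum.inr (Sum.inr o) := dif_pos rfl

lemma outEdge_of_ne (hT : T.graph.IsTree) {o : O} {v : V} (h : v ≠ T.outVertex o) :
    T.outEdge hT o v = Sum.inl ⟨s(v, T.parent hT (T.outVertex o) v), adj_parent hT h⟩ := dif_neg h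

lemma outEdge_eq_of_dist_lt (hT : T.graph.IsTree) {o : O} {v w : V} (hw : T.graph.Adj v w)
    (hd : T.graph.dist (T.outVertex o) w < T.graph.dist (T.outVertex o) v) :
    T.outEdge hT o v = Sum.inl ⟨s(v, w), hw⟩ := by
  obtain ⟨hv, h⟩ := parent_eq hT hw hd
  rw [outEdge_of_ne hT hv]
  simp only [h]

lemma incident_outEdge (hT : T.graph.IsTree) (o : O) (v : V) :
    T.Incident (T.outEdge hT o v) v := by
  by_cases h : v = T.outVertex o
  · subst h
    rw [outEdge_outVertex]
    rfl
  · rw [outEdge_of_ne hT h]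
    exact Sym2.mem_mk_left _ _

/-- A bond between `u` and `v` is the outgoing edge of one of its ends. -/
lemma outEdge_eq_or (hT : T.graph.IsTree) (o : O) {u v : V} (h : T.graph.Adj u v) :
    T.outEdge hT o u = Sum.inl ⟨s(u, v), h⟩ ∨ T.outEdge hT o v = Sum.inl ⟨s(u, v), h⟩ := by
  rcases lt_or_gt_of_ne (hT.dist_ne_of_adj (T.outVertex o) h) with hd | hd
  · right
    rw [outEdge_eq_of_dist_lt hT h.symm hd]
    simp only [Sym2.eq_swap]
  · exact Or.inl (outEdge_eq_of_dist_lt hT h hd)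

/-- A bond leading to the parent from both of its ends would make the distance to the root decrease
in both directions. -/
lemma outEdge_injective (hT : T.graph.IsTree) (o : O) : Function.Injective (T.outEdge hT o) := by
  intro u v h
  by_cases hu : u = T.outVertex o <;> by_cases hv : v = T.outVertex o
  · rw [hu, hv]
  · rw [hu, outEdge_outVertex, outEdge_of_ne hT hv] at h
    cases h
  · rw [hv, outEdge_outVertex, outEdge_of_ne hT hu] at h
    cases h
  · rw [outEdge_of_ne hT hu, outEdge_of_ne hT hv] at h
    have h1 := congrArg Subtype.val (Sum.inl.inj h)
    rcases Sym2.eq_iff.1 h1 with ⟨h2, -⟩ | ⟨h2, h3⟩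
    · exact h2
    · have h4 := dist_parent_lt hT hu
      have h5 := dist_parent_lt hT hv
      rw [h3] at h4
      rw [← h2] at h5
      omega

variable (T) [Fintype V] [Fintype I] [Fintype O]

open Classical in
/-- A tree with a single output dimension, directed towards the latter. -/
noncomputable def directed (hT : T.graph.IsTree) [Subsingleton O] (o : O) :
    DirectedNetwork V T.Edge where
  con v := Finset.univ.filter fun e => e ≠ T.outEdge hT o v ∧ T.Incident e v
  out := T.outEdge hT o
  inp := Finset.univ.filter fun e => ∃ i, e = Sum.inr (Sum.inl i)
  depth v := T.graph.dist (T.outVertex o) v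
  out_injective := outEdge_injective hT o
  out_notMem_inp v := by
    simp only [Finset.mem_filter, Finset.mem_univ, true_and, not_exists]
    intro i h
    by_cases hv : v = T.outVertex o
    · rw [hv, outEdge_outVertex] at h
      cases h
    · rw [outEdge_of_ne hT hv] at h
      cases h
  con_disjoint u v huv := by
    refine Finset.disjoint_left.2 fun e hu hv => ?_
    simp only [Finset.mem_filter, Finset.mem_univ, true_and] at hu hv
    rcases e with ⟨e, he⟩ | i | k
    · have h : e = s(u, v) := (Sym2.mem_and_mem_iff huv).1 ⟨hu.2, hv.2⟩
      subst h
      rcases outEdge_eq_or hT o he with h | h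
      · exact hu.1 h.symm
      · exact hv.1 h.symm
    · exact huv (hu.2.symm.trans hv.2)
    · exact huv (hu.2.symm.trans hv.2)
  depth_lt u v h := by
    simp only [Finset.mem_filter, Finset.mem_univ, true_and] at h
    have huv : v ≠ u := fun huv => h.1 (huv ▸ rfl)
    have h2 := h.2
    by_cases hu : u = T.outVertex o
    · rw [hu, outEdge_outVertex] at h2
      exact absurd (h2.symm.trans hu.symm) huv
    · rw [outEdge_of_ne hT hu] at h2
      rcases Sym2.mem_iff.1 h2 with h3 | h3
      · exact absurd h3 huv
      · rw [h3]
        exact dist_parent_lt hT hu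
  con_cover v e h := by
    simp only [Finset.mem_filter, Finset.mem_univ, true_and] at h ⊢
    rcases e with ⟨e, he⟩ | i | k
    · right
      induction e using Sym2.ind with
      | _ a b => exact (outEdge_eq_or hT o he).elim (fun h => ⟨a, h⟩) fun h => ⟨b, h⟩
    · exact Or.inl ⟨i, rfl⟩
    · rw [Subsingleton.elim k o]
      exact Or.inr ⟨_, outEdge_outVertex hT o⟩

variable {T} [Subsingleton O] (hT : T.graph.IsTree) (o : O)

/-- The index of the tensor at `v` in the label `l`. -/
def tensorIndex (v : V) (l : (e : T.Edge) → Fin (T.size e)) : T.TensorIndex v := fun e => l e.1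

lemma tensorIndex_eq_iff (v : V) (l l' : (e : T.Edge) → Fin (T.size e)) :
    tensorIndex v l = tensorIndex v l' ↔
      l ((T.directed hT o).out v) = l' ((T.directed hT o).out v) ∧
        ∀ e ∈ (T.directed hT o).con v, l e = l' e := by
  simp only [directed, Finset.mem_filter, Finset.mem_univ, true_and]
  constructor
  · intro h
    exact ⟨congrFun h ⟨_, incident_outEdge hT o v⟩, fun e he => congrFun h ⟨e, he.2⟩⟩
  · rintro ⟨h1, h2⟩
    ext1 ⟨e, he⟩
    by_cases h : e = T.outEdge hT o v
    · subst h
      exact h1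
    · exact h2 e ⟨h, he⟩

/-- A bond is outgoing for at most one of its ends, hence is contracted at the other. -/
lemma mem_summed_univ [DecidableEq T.Edge] (e : T.Edge) :
    e ∈ (T.directed hT o).summed Finset.univ ↔ e ≠ Sum.inr (Sum.inr o) := by
  simp only [DirectedNetwork.summed, Finset.mem_biUnion, Finset.mem_univ, true_and, directed,
    Finset.mem_filter]
  constructor
  · rintro ⟨v, h1, h2⟩ rfl
    obtain rfl : T.outVertex o = v := h2
    exact h1 (outEdge_outVertex hT o).symm
  · intro h
    rcases e with ⟨e, he⟩ | i | k
    · induction e using Sym2.ind with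
      | _ a b =>
        by_cases ha : T.outEdge hT o a = Sum.inl ⟨s(a, b), he⟩
        · refine ⟨b, fun hb => T.graph.ne_of_adj he ?_, Sym2.mem_mk_right _ _⟩
          exact outEdge_injective hT o (ha.trans hb)
        · exact ⟨a, Ne.symm ha, Sym2.mem_mk_left _ _⟩
    · refine ⟨T.inVertex i, fun h => ?_, rfl⟩
      have := (T.directed hT o).out_notMem_inp (T.inVertex i)
      simp only [directed, ← h] at this
      simp at this
    · rw [Subsingleton.elim k o] at h
      exact absurd rfl h

lemma present_univ [DecidableEq T.Edge] :
    (T.directed hT o).present Finset.univ = {Sum.inr (Sum.inr o)} := by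
  ext e
  simp only [DirectedNetwork.present, Finset.mem_sdiff, mem_summed_univ, Finset.mem_singleton,
    ne_eq, not_not, and_iff_right_iff_imp]
  rintro rfl
  exact Finset.mem_union_right _
    (Finset.mem_image.2 ⟨_, Finset.mem_univ _, outEdge_outVertex hT o⟩)

end Directed

end TensorNetworkEmbedding

/-! ### The embedding matrix as the state of the directed network -/

lemma IsIIDStandardNormal.map_eq_pi {V : Type*} [Fintype V] {K : V → Type*} [∀ v, Fintype (K v)]
    {Ω : Type*} [MeasurableSpace Ω] {P : Measure Ω} {Z : (v : V) → K v → Ω → ℝ}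
    (h : IsIIDStandardNormal P Z) :
    P.map (fun ω v k => Z v k ω) =
      Measure.pi fun v => Measure.pi fun _ : K v => gaussianReal 0 1 := by
  have hm : AEMeasurable (fun ω (p : (v : V) × K v) => Z p.1 p.2 ω) P :=
    aemeasurable_pi_lambda _ fun p => (h.1 p.1 p.2).aemeasurable
  have h1 : P.map (fun ω (p : (v : V) × K v) => Z p.1 p.2 ω) =
      Measure.infinitePi fun _ => gaussianReal 0 1 := by
    rw [h.2.map_fun_eq_pi_map (f := fun (p : (v : V) × K v) => Z p.1 p.2) fun p =>
      (h.1 p.1 p.2).aemeasurable, Measure.infinitePi_eq_pi]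
    congr 1 with p
    rw [(h.1 p.1 p.2).map_eq]
  have h2 := Measure.infinitePi_map_piCurry (κ := K) (fun _ _ => gaussianReal 0 1)
  simp only [Measure.infinitePi_eq_pi] at h1 h2
  rw [← h2, ← h1, AEMeasurable.map_map_of_aemeasurable (by fun_prop) hm]
  rfl

namespace TensorNetworkEmbedding

variable {V I O : Type*} {T : TensorNetworkEmbedding V I O}

/-- This allows the normalization belonging to `σ` to be replaced by a uniform one, adapted to the
orientation towards the output. -/
lemma contract_smul_eq [Fintype V] (c d : V → ℝ) (h : ∏ v, c v = ∏ v, d v)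
    (A : ∀ v, T.TensorIndex v → ℝ) :
    (T.contract fun v k => c v * A v k) = T.contract fun v k => d v * A v k := by
  simp only [contract, Finset.prod_mul_distrib, h]

lemma size_outEdge (hT : T.graph.IsTree) (o : O) {m : ℕ} (ho : ∀ k, T.outDim k = m)
    (hb : ∀ e, T.bondDim e = m) (v : V) :
    T.size (T.outEdge hT o v) = m := by
  by_cases hv : v = T.outVertex o
  · rw [hv, outEdge_outVertex]
    exact ho o
  · rw [outEdge_of_ne hT hv]
    exact hb _

variable [Fintype V] [Fintype I] [Fintype O] [Subsingleton O] (hT : T.graph.IsTree) (o : O)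

/-- The output indices in the label `l`. -/
def outIndex (l : (e : T.Edge) → Fin (T.size e)) : T.OutIndex := fun k => l (Sum.inr (Sum.inr k))

/-- The vector `x` as a function of the label. -/
def inputArray (x : T.InIndex → ℝ) (l : (e : T.Edge) → Fin (T.size e)) : ℝ :=
  x fun i => l (Sum.inr (Sum.inl i))

lemma mem_directed_inp (e : T.Edge) :
    e ∈ (T.directed hT o).inp ↔ ∃ i, e = Sum.inr (Sum.inl i) := by
  simp [directed]

lemma dependsOn_inputArray (x : T.InIndex → ℝ) :
    DependsOn (inputArray x) ((T.directed hT o).inp : Set T.Edge) := fun l l' h => by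
  unfold inputArray
  congr 1
  ext1 i
  exact h _ ((mem_directed_inp hT o _).2 ⟨i, rfl⟩)

lemma partialSum_inputArray_sq [DecidableEq I] [DecidableEq T.Edge] (x : T.InIndex → ℝ)
    (l : (e : T.Edge) → Fin (T.size e)) :
    partialSum (T.directed hT o).inp (fun l => inputArray x l ^ 2) l = ∑ i, x i ^ 2 := by
  have hi : ∀ i, (Sum.inr (Sum.inl i) : T.Edge) ∈ (T.directed hT o).inp := fun i =>
    (mem_directed_inp hT o _).2 ⟨i, rfl⟩
  refine Fintype.sum_bijective
    (fun y i => y ⟨Sum.inr (Sum.inl i), hi i⟩ : _ → T.InIndex) ⟨fun y y' h => ?_, fun i => ?_⟩ _ _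
    fun y => ?_
  · ext1 ⟨e, he⟩
    obtain ⟨i, rfl⟩ := (mem_directed_inp hT o _).1 he
    exact congrFun h i
  · let l' : (e : T.Edge) → Fin (T.size e) := fun e => match e with
      | Sum.inl e => l (Sum.inl e)
      | Sum.inr (Sum.inl k) => i k
      | Sum.inr (Sum.inr k) => l (Sum.inr (Sum.inr k))
    exact ⟨fun e => l' e.1, rfl⟩
  · simp only [inputArray, Function.updateFinset, hi, dif_pos]

lemma state_eq_mulVec [DecidableEq I] [DecidableEq T.Edge] (a : ℝ) (A : ∀ v, T.TensorIndex v → ℝ)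
    (x : T.InIndex → ℝ) (l : (e : T.Edge) → Fin (T.size e)) :
    (T.directed hT o).state a tensorIndex (inputArray x) Finset.univ A l =
      (T.contract fun v k => a * A v k).mulVec x (outIndex l) := by
  classical
  have hR : (T.contract fun v k => a * A v k).mulVec x (outIndex l) =
      ∑ p : T.InIndex × T.BondIndex,
        (∏ v, a * A v fun e => T.label (outIndex l) p.1 p.2 e.1) * x p.1 := by
    rw [Fintype.sum_prod_type]
    exact Finset.sum_congr rfl fun i _ => Finset.sum_mul _ _ _
  rw [hR]
  have hi : ∀ i, (Sum.inr (Sum.inl i) : T.Edge) ∈ (T.directed hT o).summed Finset.univ := fun i =>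
    (mem_summed_univ hT o _).2 (by simp)
  have hb : ∀ b, (Sum.inl b : T.Edge) ∈ (T.directed hT o).summed Finset.univ := fun i =>
    (mem_summed_univ hT o _).2 (by simp)
  have ho : ∀ k, (Sum.inr (Sum.inr k) : T.Edge) ∉ (T.directed hT o).summed Finset.univ := fun k =>
    fun h => (mem_summed_univ hT o _).1 h (by rw [Subsingleton.elim k o])
  refine Fintype.sum_bijective
    (fun y => (fun i => y ⟨Sum.inr (Sum.inl i), hi i⟩, fun b => y ⟨Sum.inl b, hb b⟩) :
      _ → T.InIndex × T.BondIndex) ⟨fun y y' h => ?_, fun ⟨i, b⟩ => ?_⟩ _ _ fun y => ?_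
  · ext1 ⟨e, he⟩
    rcases e with e | i | k
    · exact congrFun (Prod.ext_iff.1 h).2 e
    · exact congrFun (Prod.ext_iff.1 h).1 i
    · exact absurd he (ho k)
  · exact ⟨fun e => T.label (outIndex l) i b e.1, rfl⟩
  · have hl : Function.updateFinset l ((T.directed hT o).summed Finset.univ) y =
        T.label (outIndex l) (fun i => y ⟨Sum.inr (Sum.inl i), hi i⟩)
          (fun b => y ⟨Sum.inl b, hb b⟩) := by
      ext1 e
      rcases e with e | i | k
      · simp only [Function.updateFinset, hb, dif_pos, label]
      · simp only [Function.updateFinset, hi, dif_pos, label]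
      · simp only [Function.updateFinset, ho, dif_neg, not_false_eq_true, label, outIndex]
    rw [hl]
    rfl

lemma energy_eq_norm_sq [DecidableEq I] [DecidableEq O] [DecidableEq T.Edge] (a : ℝ)
    (A : ∀ v, T.TensorIndex v → ℝ) (x : T.InIndex → ℝ) (l : (e : T.Edge) → Fin (T.size e)) :
    (T.directed hT o).energy a tensorIndex (inputArray x) l Finset.univ A =
      ‖WithLp.toLp 2 ((T.contract fun v k => a * A v k).mulVec x)‖ ^ 2 := by
  rw [EuclideanSpace.real_norm_sq_eq, DirectedNetwork.energy, present_univ]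
  have ho : ∀ k, (Sum.inr (Sum.inr k) : T.Edge) ∈ ({Sum.inr (Sum.inr o)} : Finset T.Edge) :=
    fun k => by rw [Subsingleton.elim k o, Finset.mem_singleton]
  refine Fintype.sum_bijective
    (fun y k => y ⟨Sum.inr (Sum.inr k), ho k⟩ : _ → T.OutIndex) ⟨fun y y' h => ?_, fun k => ?_⟩
    _ _ fun y => ?_
  · ext1 ⟨e, he⟩
    obtain rfl := Finset.mem_singleton.1 he
    exact congrFun h o
  · let l' : (e : T.Edge) → Fin (T.size e) := fun e => match e with
      | Sum.inl e => l (Sum.inl e)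
      | Sum.inr (Sum.inl i) => l (Sum.inr (Sum.inl i))
      | Sum.inr (Sum.inr j) => k j
    exact ⟨fun e => l' e.1, rfl⟩
  · have h : outIndex (Function.updateFinset l {Sum.inr (Sum.inr o)} y) =
        fun k => y ⟨Sum.inr (Sum.inr k), ho k⟩ := by
      ext1 k
      simp only [outIndex, Function.updateFinset, ho, dif_pos]
      rfl
    exact congrArg (· ^ 2) ((state_eq_mulVec hT o a A x _).trans (by rw [h]))

/-- Accuracy of a tree of Gaussian tensors with a single output dimension. -/
theorem isAccurateEmbedding_of_isTree (hT : T.graph.IsTree) (o : O) [DecidableEq I]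
    [DecidableEq O] {ε δ δ₀ : ℝ} (hε : 0 < ε) (hε1 : ε ≤ 1) (hδ : 0 < δ) (hδδ₀ : δ ≤ δ₀) (hδ₀ : δ₀ < 1) {m : ℕ}
    (ho : ∀ k, T.outDim k = m) (hb : ∀ e, T.bondDim e = m) (σ : V ≃ Fin (Fintype.card V))
    {Ω : Type*} [MeasurableSpace Ω] {P : Measure Ω} [IsProbabilityMeasure P]
    {Z : (v : V) → T.TensorIndex v → Ω → ℝ} (hZ : IsIIDStandardNormal P Z)
    (hm : 128 * (1 + 1 / Real.log (1 / δ₀)) *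
      (Fintype.card V * Real.log (1 / δ) / ε ^ 2) ≤ m) :
    IsAccurateEmbedding P (T.embeddingMatrix σ Z) ε δ := by
  classical
  intro x hx
  have hV : 1 ≤ Fintype.card V := Fintype.card_pos_iff.2 ⟨T.outVertex o⟩
  have hm0 : 0 < m := by
    have h1 : 0 < Real.log (1 / δ) :=
      Real.log_pos (by rw [one_lt_div hδ]; exact hδδ₀.trans_lt hδ₀)
    have h2 : 0 < Real.log (1 / δ₀) :=
      Real.log_pos (by rw [one_lt_div (hδ.trans_le hδδ₀)]; exact hδ₀)
    have h3 : (0 : ℝ) < Fintype.card V := by exact_mod_cast hV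
    have : (0 : ℝ) < m := lt_of_lt_of_le (by positivity) hm
    exact_mod_cast this
  -- The network sums are functions of a full label, so a base label `l` must exist. A unit vector
  -- forces nonempty input dimensions, and `m > 0` handles the other edges.
  obtain ⟨i₀⟩ : Nonempty T.InIndex := by
    by_contra h
    rw [not_nonempty_iff] at h
    rw [Subsingleton.elim x 0, norm_zero] at hx
    exact zero_ne_one hx
  let l : (e : T.Edge) → Fin (T.size e) := T.label (fun k => ⟨0, by rw [ho]; exact hm0⟩) i₀
    (fun e => ⟨0, by rw [hb]; exact hm0⟩)
  set a : ℝ := 1 / √m with ha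
  have hmR : (0 : ℝ) < m := by exact_mod_cast hm0
  have ha0 : 0 < a := by positivity
  have ha2 : a ^ 2 = 1 / m := by rw [ha, div_pow, one_pow, Real.sq_sqrt hmR.le]
  have hscale : ∏ v, 1 / √(T.rowSize σ v : ℝ) = ∏ _v : V, a := by
    have h := T.prod_rowSize_eq_pow σ hT (Fintype.card_eq_one_iff.2
      ⟨o, fun k => Subsingleton.elim k o⟩) ho hb
    rw [Finset.prod_div_distrib, ← Real.sqrt_prod _ (fun _ _ => by positivity), ← Nat.cast_prod, h,
      Finset.prod_const, Finset.prod_const, one_pow, ha, div_pow, one_pow, Finset.card_univ,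
      Nat.cast_pow]
    congr 1
    rw [Real.sqrt_eq_iff_mul_self_eq (by positivity) (by positivity), ← mul_pow,
      Real.mul_self_sqrt hmR.le]
  set N := T.directed hT o with hN
  set Y : (∀ v, T.TensorIndex v → ℝ) → ℝ :=
    N.energy a tensorIndex (inputArray x.ofLp) l Finset.univ with hY
  have hYm : Measurable Y := DirectedNetwork.measurable_energy l _
  set μ : Measure (∀ v, T.TensorIndex v → ℝ) :=
    Measure.pi fun v => Measure.pi fun _ : T.TensorIndex v => gaussianReal 0 1 with hμ
  have hlaw : P.map (fun ω v k => Z v k ω) = μ := hZ.map_eq_pi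
  have hWm : AEMeasurable (fun ω v k => Z v k ω) P :=
    aemeasurable_pi_lambda _ fun v => aemeasurable_pi_lambda _ fun k => (hZ.1 v k).aemeasurable
  have hnorm : ∀ ω, ‖WithLp.toLp 2 ((T.embeddingMatrix σ Z ω).mulVec x)‖ ^ 2 =
      Y fun v k => Z v k ω := by
    intro ω
    rw [hY, hN, energy_eq_norm_sq, embeddingMatrix, contract_smul_eq _ (fun _ => a) hscale]
  have hcard : ∀ v, Fintype.card (∀ e : ({N.out v} : Finset T.Edge), Fin (T.size e)) = m := by
    intro v
    rw [Fintype.card_pi, Finset.prod_coe_sort {N.out v} fun e => Fintype.card (Fin (T.size e)),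
      Finset.prod_singleton, Fintype.card_fin]
    exact size_outEdge hT o ho hb v
  have hne : ∀ v, Nonempty (∀ e : ({N.out v} : Finset T.Edge), Fin (T.size e)) := fun v =>
    Fintype.card_pos_iff.1 (by rw [hcard]; exact hm0)
  have ham : a ^ 2 * m = 1 := by rw [ha2]; field_simp
  have hmoment : ∀ (s : ℝ) (κ : ENNReal), (1 ≤ s ∨ s < 0) →
      (∀ v, chiSquareMoment (∀ e : ({N.out v} : Finset T.Edge), Fin (T.size e)) a s ≤ κ) →
      ∫⁻ A, ENNReal.ofReal (Y A) ^ s ∂μ ≤ κ ^ Fintype.card V := by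
    intro s κ hs hκ
    -- All tensors are integrated out, so the base array `0` is immaterial.
    have h := DirectedNetwork.lmarginal_energy_le (N := N) (tensorIndex_eq_iff hT o)
      (dependsOn_inputArray hT o x.ofLp) hs hκ l Finset.univ (fun _ _ _ _ => Finset.mem_univ _)
      (fun _ _ => 0)
    rw [lmarginal_univ, hN, partialSum_inputArray_sq, ← EuclideanSpace.real_norm_sq_eq, hx] at h
    simpa using h
  have hmain : μ.real {A | ε < |Y A - 1|} < δ := by
    refine measureReal_abs_sub_one_lt μ hYm hε hε1 hδ hδδ₀ hδ₀ hV hm (fun p hp => ?_)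
      fun p hp hpm => ?_
    · refine hmoment _ _ (Or.inl (by exact_mod_cast hp)) fun v => ?_
      have := hne v
      have h := chiSquareMoment_natCast_le (∀ e : ({N.out v} : Finset T.Edge), Fin (T.size e)) ha0
        (by rw [hcard, ham]) p
      rwa [ha2, one_div_mul_eq_div] at h
    · refine hmoment _ _ (Or.inr (by simpa using Nat.lt_of_lt_of_le one_pos hp)) fun v => ?_
      have := hne v
      have h := chiSquareMoment_neg_natCast_le (∀ e : ({N.out v} : Finset T.Edge), Fin (T.size e))
        ha0 (by rw [hcard, ham]) p (by rwa [hcard])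
      rwa [ha2, one_div_mul_eq_div] at h
  have hms : MeasurableSet {A | ε < |Y A - 1|} :=
    measurableSet_lt measurable_const (hYm.sub_const 1).abs
  simp only [hnorm]
  rw [← hlaw, map_measureReal_apply_of_aemeasurable hWm hms] at hmain
  exact hmain

end TensorNetworkEmbedding

theorem corollary3p1 (δ₀ : ℝ) (hδ₀ : δ₀ < 1) :
    ∃ C : ℝ, 0 < C ∧
      ∀ (ε δ : ℝ), 0 < ε → ε ≤ 1 → 0 < δ → δ ≤ δ₀ →
      ∀ (V I O : Type*) [Fintype V] [Fintype I] [DecidableEq I] [Fintype O] [DecidableEq O]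
        (T : TensorNetworkEmbedding V I O) (m : ℕ),
        Fintype.card O = 1 →
        (∀ o, T.outDim o = m) →
        (∀ e, T.bondDim e = m) →
      ∀ (σ : V ≃ Fin (Fintype.card V))
        (Ω : Type*) [MeasurableSpace Ω] (P : Measure Ω) [IsProbabilityMeasure P]
        (Z : (v : V) → T.TensorIndex v → Ω → ℝ), IsIIDStandardNormal P Z →
        (T.graph.IsTree →
          C * (Fintype.card V * Real.log (1 / δ) / ε ^ 2) ≤ m →
          IsAccurateEmbedding P (T.embeddingMatrix σ Z) ε δ) ∧
        (T.IsTensorTrain →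
          C * (Fintype.card I * Real.log (1 / δ) / ε ^ 2) ≤ m →
          IsAccurateEmbedding P (T.embeddingMatrix σ Z) ε δ) := by
  rcases le_or_gt δ₀ 0 with h0 | h0
  -- No `δ` satisfies `0 < δ ≤ δ₀` here, so any positive constant works.
  · exact ⟨1, one_pos, fun _ _ _ _ hδ hδδ₀ => absurd (hδ.trans_le hδδ₀) h0.not_gt⟩
  have hL : 0 < Real.log (1 / δ₀) := Real.log_pos (by rw [one_lt_div h0]; exact hδ₀)
  refine ⟨128 * (1 + 1 / Real.log (1 / δ₀)), by positivity, ?_⟩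
  intro ε δ hε hε1 hδ hδδ₀ V I O _ _ _ _ _ T m hO ho hb σ Ω _ P _ Z hZ
  obtain ⟨o, hoo⟩ := Fintype.card_eq_one_iff.1 hO
  have : Subsingleton O := ⟨fun k k' => (hoo k).trans (hoo k').symm⟩
  refine ⟨fun hT hm => ?_, fun hT hm => ?_⟩
  · exact TensorNetworkEmbedding.isAccurateEmbedding_of_isTree hT o hε hε1 hδ hδδ₀ hδ₀ ho
      hb σ hZ hm
  · have : Nonempty V := ⟨T.outVertex o⟩
    rw [Fintype.card_of_bijective hT.1] at hm
    exact TensorNetworkEmbedding.isAccurateEmbedding_of_isTree hT.isTree o hε hε1 hδ hδδ₀ hδ₀ ho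
      hb σ hZ hm
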